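/- Let $1<\alpha<2$ be such that $1724-2\alpha-570\alpha^2-30\alpha^3+30\alpha^4\neq 0$, and put $$\gamma_1=\frac{350+331\alpha-15\alpha^2-75\alpha^3-15\alpha^4}{1724-2\alpha-570\alpha^2-30\alpha^3+30\alpha^4},\qquad \gamma_2=\frac{566-329\alpha-135\alpha^2+105\alpha^3-15\alpha^4}{1724-2\alpha-570\alpha^2-30\alpha^3+30\alpha^4},$$ $$\mu_1=\frac{566+329\alpha-135\alpha^2-105\alpha^3-15\alpha^4}{1724-2\alpha-570\alpha^2-30\alpha^3+30\alpha^4},\qquad \mu_0=\frac{862+\alpha-285\alpha^2+15\alpha^3+15\alpha^4}{862-\alpha-285\alpha^2-15\alpha^3+15\alpha^4},$$ $$\mu_{-1}=\frac{350-331\alpha-15\alpha^2+75\alpha^3-15\alpha^4}{1724-2\alpha-570\alpha^2-30\alpha^3+30\alpha^4}.$$ (i) Let $a_{p,l}$ denote the coefficient of $z^l$ in the power series expansion at $0$ of $\left(\frac{1-e^{-z}}{z}\right)^{\alpha}e^{pz}$. Then $(\gamma_1,\gamma_2,\mu_1,\mu_0,\mu_{-1})$ is the unique real solution of the linear system $$\mu_1+\mu_0+\mu_{-1}-\gamma_1-\gamma_2=1,$$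 $$\mu_1a_{1,l}+\mu_0a_{0,l}+\mu_{-1}a_{-1,l}-\frac{(-1)^l}{l!}\gamma_1-\frac{1}{l!}\gamma_2=0,\qquad l=1,2,3,4.$$ (ii) Let $u\in C^8(\mathbb R)$ be real-valued with $u^{(k)}\in L^1(\mathbb R)$ for $k=0,1,\dots,8$. Let $$D^\alpha u(x)=\frac{1}{\Gamma(2-\alpha)}\frac{d^2}{dx^2}\int_{-\infty}^x (x-s)^{1-\alpha}u(s)\,ds$$ be the left Riemann--Liouville derivative with lower terminal $-\infty$, and, for $h>0$ and $p\in\mathbb Z$, let $$\Delta_p^\alpha u(x)=\frac1{h^\alpha}\sum_{k=0}^\infty g_k^{(\alpha)}\,u(x-(k-p)h),\qquad g_k^{(\alpha)}=\frac{\Gamma(k-\alpha)}{\Gamma(-\alpha)\Gamma(k+1)},$$ be the shifted Grünwald--Letnikov operator. Then $D^\alpha u$ and $\Delta_p^\alpha u$ are well defined everywhere on $\mathbb R$ (the integral converges absolutely for every $x$ and is a $C^2$ function of $x$, and the series converges absolutely for all $h>0$, $p\in\mathbb Z$, $x\in\mathbb R$), and $$\gamma_1D^\alpha u(x-h)+D^\alpha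 u(x)+\gamma_2D^\alpha u(x+h)=\mu_1\Delta_1^\alpha u(x)+\mu_0\Delta_0^\alpha u(x)+\mu_{-1}\Delta_{-1}^\alpha u(x)+O(h^5)$$ as $h\to0^+$, uniformly in $x\in\mathbb R$. -/

import Mathlib

open MeasureTheory Set

noncomputable section

namespace FifthOrderCWSGD

/-- The integral `∫_{-∞}^x (x - s)^(n - α - 1) u(s) ds` with `n = ⌈α⌉`, so `n - 1 < α < n` for
non-integer `α > 0`. -/
def leftRLIntegral (α : ℝ) (u : ℝ → ℝ) (x : ℝ) : ℝ :=
  ∫ s in Iio x, (x - s) ^ ((⌈α⌉₊ : ℝ) - α - 1) * u s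

/-- The left Riemann-Liouville derivative of order `α` (non-integer, positive) with lower
terminal `-∞`. -/
def leftRL (α : ℝ) (u : ℝ → ℝ) (x : ℝ) : ℝ :=
  1 / Real.Gamma ((⌈α⌉₊ : ℝ) - α) * iteratedDeriv ⌈α⌉₊ (leftRLIntegral α u) x

/-- The Grünwald weights `g_k = Γ(k - α) / (Γ(-α) Γ(k + 1))`. -/
def grunwaldWeight (α : ℝ) (k : ℕ) : ℝ :=
  Real.Gamma ((k : ℝ) - α) / (Real.Gamma (-α) * Real.Gamma ((k : ℝ) + 1))

/-- The `k`-th term `g_k u(x - (k - p) h)` of the shifted Grünwald-Letnikov series. -/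
def grunwaldTerm (α h : ℝ) (p : ℤ) (u : ℝ → ℝ) (x : ℝ) (k : ℕ) : ℝ :=
  grunwaldWeight α k * u (x - ((k : ℝ) - (p : ℝ)) * h)

/-- The left shifted Grünwald-Letnikov operator `Δ_p^α` with step size `h`. -/
def shiftedGrunwald (α h : ℝ) (p : ℤ) (u : ℝ → ℝ) (x : ℝ) : ℝ :=
  1 / h ^ α * ∑' k : ℕ, grunwaldTerm α h p u x k

/-- The function `((1 - e^(-z)) / z)^α e^(p z)`, with its limit value `1` at `z = 0`.
The base of the power is positive for every real `z`. -/
def expansionFunction (α : ℝ) (p : ℤ) (z : ℝ) : ℝ :=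
  (if z = 0 then 1 else (1 - Real.exp (-z)) / z) ^ α * Real.exp ((p : ℝ) * z)

/-- The coefficient `a_{p,l}` of `z^l` in the power series of `((1 - e^(-z)) / z)^α e^(p z)`. -/
def expansionCoeff (α : ℝ) (p : ℤ) (l : ℕ) : ℝ :=
  iteratedDeriv l (expansionFunction α p) 0 / (l.factorial : ℝ)

/-- The five linear equations for the weights `g₁, g₂` (of the derivative at `x - h`, `x + h`)
and `m₁, m₀, m₂` (of the operators with shifts `1, 0, -1`). -/
def CoefficientSystem (α g₁ g₂ m₁ m₀ m₂ : ℝ) : Prop :=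
  m₁ + m₀ + m₂ - g₁ - g₂ = 1 ∧
  m₁ * expansionCoeff α 1 1 + m₀ * expansionCoeff α 0 1 + m₂ * expansionCoeff α (-1) 1
    + g₁ - g₂ = 0 ∧
  m₁ * expansionCoeff α 1 2 + m₀ * expansionCoeff α 0 2 + m₂ * expansionCoeff α (-1) 2
    - g₁ / 2 - g₂ / 2 = 0 ∧
  m₁ * expansionCoeff α 1 3 + m₀ * expansionCoeff α 0 3 + m₂ * expansionCoeff α (-1) 3
    + g₁ / 6 - g₂ / 6 = 0 ∧
  m₁ * expansionCoeff α 1 4 + m₀ * expansionCoeff α 0 4 + m₂ * expansionCoeff α (-1) 4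
    - g₁ / 24 - g₂ / 24 = 0

/-- The common denominator of the coefficients. -/
def denom (α : ℝ) : ℝ := 1724 - 2 * α - 570 * α ^ 2 - 30 * α ^ 3 + 30 * α ^ 4

def gammaOne (α : ℝ) : ℝ :=
  (350 + 331 * α - 15 * α ^ 2 - 75 * α ^ 3 - 15 * α ^ 4) / denom α

def gammaTwo (α : ℝ) : ℝ :=
  (566 - 329 * α - 135 * α ^ 2 + 105 * α ^ 3 - 15 * α ^ 4) / denom α

def muOne (α : ℝ) : ℝ :=
  (566 + 329 * α - 135 * α ^ 2 - 105 * α ^ 3 - 15 * α ^ 4) / denom α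

def muZero (α : ℝ) : ℝ :=
  (862 + α - 285 * α ^ 2 + 15 * α ^ 3 + 15 * α ^ 4) /
    (862 - α - 285 * α ^ 2 - 15 * α ^ 3 + 15 * α ^ 4)

def muNegOne (α : ℝ) : ℝ :=
  (350 - 331 * α - 15 * α ^ 2 + 75 * α ^ 3 - 15 * α ^ 4) / denom α

/-- The 5-CWSGD operator applied to a function `v`:
`γ₁ v(x - h) + v(x) + γ₂ v(x + h)`. -/
def fiveCWSGD (α h : ℝ) (v : ℝ → ℝ) (x : ℝ) : ℝ :=
  gammaOne α * v (x - h) + v x + gammaTwo α * v (x + h)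

end FifthOrderCWSGD

end

/-! The proof is a Fourier multiplier estimate. Write `u x = ∫ V w * exp (2πiwx)` with `V`
continuous and `O(|w|^(-8))`, and put `z = 2πiwh`. Then `D^α` multiplies `V` by `h^(-α) z^α`, and
`Δ_p^α` multiplies it by `h^(-α) (1 - e^(-z))^α e^(pz)`. The scheme error is therefore the integral
of `V w * exp (2πiwx)` against `h^(-α) * symbolError α z` (`scheme_error_eq_integral`).

After removal of the factor `z^α`, the symbol error is analytic at `0`, and its Taylor coefficients
of order `0, ..., 4` vanish precisely by the five linear equations. Hence it is `O(|z|^(5+α))` near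
`0`, and crude bounds extend this to the whole imaginary axis (`exists_norm_symbolError_le`). Since
`5 + α < 7`, the weight `|w|^(5+α)` is integrable against `V`, and the bound `C h^5` does not depend
on `x`.

The multiplier of `D^α` comes from the Laplace transform of a power, by a damping limit
(`leftRL_eq_integral`); that of `Δ_p^α` comes from the binomial series on the unit circle
(`tsum_grunwaldTerm_eq_integral`). Uniqueness in (i) reduces to a 2×2 determinant equal to `α² *
denom α / 960`. -/

noncomputable section

namespace FifthOrderCWSGD

open Filter Topology

/-! ### Taylor coefficients of the generating function, over `ℝ` and `ℂ` together. -/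

section TaylorCoefficients

variable {𝕜 : Type*} [RCLike 𝕜] {b e f : 𝕜 → 𝕜}

/-- Differentiate `z * b z = 1 - e z` at `0` by Leibniz, `n + 1` times: only the term with one
derivative on `z` survives. -/
lemma iteratedDeriv_of_mul_eq_one_sub (hb : AnalyticAt 𝕜 b 0) (he : AnalyticAt 𝕜 e 0)
    (hbe : ∀ᶠ z in 𝓝 (0 : 𝕜), z * b z = 1 - e z)
    (hen : ∀ n, iteratedDeriv n e 0 = (-1) ^ n) (n : ℕ) :
    iteratedDeriv n b 0 = (-1) ^ n / (n + 1) := by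
  have h1 : iteratedDeriv (n + 1) (fun z : 𝕜 => z * b z) 0 = (n + 1) * iteratedDeriv n b 0 := by
    rw [iteratedDeriv_fun_mul (f := fun z : 𝕜 => z) contDiffAt_id hb.contDiffAt, Finset.sum_eq_single 1]
    · simp [iteratedDeriv_one]
    · intro i _ hi
      simp [iteratedDeriv_fun_id_zero, hi]
    · simp
  have h2 : iteratedDeriv (n + 1) (fun z : 𝕜 => 1 - e z) 0 = -(-1) ^ (n + 1) := by
    rw [iteratedDeriv_fun_sub contDiffAt_const he.contDiffAt, hen, iteratedDeriv_const]
    simp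
  have h3 := (Filter.EventuallyEq.iteratedDeriv_eq (n + 1) hbe).symm.trans h1
  have hn : (n + 1 : 𝕜) ≠ 0 := by exact_mod_cast n.succ_ne_zero
  rw [h2] at h3
  rw [eq_div_iff hn, mul_comm, ← h3]
  ring

/-- The coefficient of `z ^ l` (`l ≤ 4`) in the expansion of `((1 - e^(-z)) / z)^α e^(p z)`. -/
def taylorCoeff (α p : 𝕜) : ℕ → 𝕜
  | 0 => 1
  | 1 => p - α / 2
  | 2 => (p - α / 2) ^ 2 / 2 + α / 24
  | 3 => (p - α / 2) ^ 3 / 6 + (p - α / 2) * α / 24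
  | 4 => (p - α / 2) ^ 4 / 24 + (p - α / 2) ^ 2 * α / 48 + α ^ 2 / 1152 - α / 2880
  | _ => 0

/-- The logarithmic derivative of `b^α e^(pz)` gives the equation `hode`; differentiating it at `0`
yields a triangular recursion for the derivatives of `f`. The coefficients are polynomials in `p - α
/ 2` because `(1 - e^(-z)) / z = e^(-z/2) * sinh(z/2) / (z/2)`, whose second factor is even. -/
lemma iteratedDeriv_eq_taylorCoeff (hb : AnalyticAt 𝕜 b 0) (hf : AnalyticAt 𝕜 f 0) {α p : 𝕜}
    (hbn : ∀ n, iteratedDeriv n b 0 = (-1) ^ n / (n + 1)) (hf0 : f 0 = 1)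
    (hode : ∀ᶠ z in 𝓝 (0 : 𝕜), b z * deriv f z = (α * deriv b z + p * b z) * f z)
    {l : ℕ} (hl : l < 5) :
    iteratedDeriv l f 0 = l.factorial * taylorCoeff α p l := by
  have key : ∀ n : ℕ, ∑ i ∈ Finset.range (n + 1),
      (n.choose i : 𝕜) * iteratedDeriv i b 0 * iteratedDeriv (n - i + 1) f 0 =
      ∑ i ∈ Finset.range (n + 1), (n.choose i : 𝕜) *
        (α * iteratedDeriv (i + 1) b 0 + p * iteratedDeriv i b 0) * iteratedDeriv (n - i) f 0 := by
    intro n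
    have h1 := Filter.EventuallyEq.iteratedDeriv_eq n hode
    have hcb : ContDiffAt 𝕜 n b 0 := hb.contDiffAt
    have hcb' : ContDiffAt 𝕜 n (deriv b) 0 := hb.deriv.contDiffAt
    rw [iteratedDeriv_fun_mul hcb hf.deriv.contDiffAt,
      iteratedDeriv_fun_mul ((contDiffAt_const.mul hcb').add (contDiffAt_const.mul hcb))
        hf.contDiffAt] at h1
    convert h1 using 2 with i hi i hi
    · rw [iteratedDeriv_succ']
    · have hin : (i : WithTop ℕ∞) ≤ n := by
        exact_mod_cast Nat.lt_succ_iff.mp (Finset.mem_range.mp hi)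
      rw [iteratedDeriv_fun_add ((contDiffAt_const.mul hcb').of_le hin)
          ((contDiffAt_const.mul hcb).of_le hin),
        iteratedDeriv_const_mul_field, iteratedDeriv_const_mul_field, ← iteratedDeriv_succ']
  have k0 := key 0
  have k1 := key 1
  have k2 := key 2
  have k3 := key 3
  simp only [Finset.sum_range_succ, Finset.sum_range_zero, hbn, Nat.choose]
    at k0 k1 k2 k3
  norm_num [iteratedDeriv_zero, hf0] at k0 k1 k2 k3
  set f1 := deriv f 0
  set f2 := iteratedDeriv 2 f 0
  set f3 := iteratedDeriv 3 f 0
  set f4 := iteratedDeriv 4 f 0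
  have e1 : f1 = p - α / 2 := by linear_combination k0
  have e2 : f2 = 2 * ((p - α / 2) ^ 2 / 2 + α / 24) := by
    rw [e1] at k1; linear_combination k1
  have e3 : f3 = 6 * ((p - α / 2) ^ 3 / 6 + (p - α / 2) * α / 24) := by
    rw [e1, e2] at k2; linear_combination k2
  have e4 : f4 = 24 * ((p - α / 2) ^ 4 / 24 + (p - α / 2) ^ 2 * α / 48 + α ^ 2 / 1152
      - α / 2880) := by
    rw [e1, e2, e3] at k3; linear_combination k3
  interval_cases l
  · simp [hf0, taylorCoeff]
  · simpa [taylorCoeff, iteratedDeriv_one] using e1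
  · simpa [taylorCoeff] using e2
  · simpa [taylorCoeff, Nat.factorial] using e3
  · simpa [taylorCoeff, Nat.factorial] using e4

end TaylorCoefficients

/-- The singularity is removable: the function is `dslope g 0`. -/
lemma analyticAt_ite_div {𝕜 : Type*} [RCLike 𝕜] {g : 𝕜 → 𝕜} (hg : AnalyticAt 𝕜 g 0)
    (h0 : g 0 = 0) (h1 : deriv g 0 = 1) :
    AnalyticAt 𝕜 (fun z => open Classical in if z = 0 then 1 else g z / z) 0 := by
  obtain ⟨q, hq⟩ := hg
  have h := hq.has_fpower_series_dslope_fslope.analyticAt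
  convert! h using 1
  ext z
  by_cases hz : z = 0
  · simp [hz, h1]
  · simp [hz, dslope_of_ne, slope_def_field, h0]

/-- The function `(1 - e^(-z)) / z` on `ℂ`, with value `1` at `0`. -/
def expQuotient (z : ℂ) : ℂ := if z = 0 then 1 else (1 - Complex.exp (-z)) / z

/-- The function `(1 - e^(-x)) / x` on `ℝ`, with value `1` at `0`. -/
def realExpQuotient (x : ℝ) : ℝ := if x = 0 then 1 else (1 - Real.exp (-x)) / x

lemma mul_expQuotient (z : ℂ) : z * expQuotient z = 1 - Complex.exp (-z) := by
  unfold expQuotient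
  split_ifs with h
  · simp [h]
  · field_simp

lemma mul_realExpQuotient (x : ℝ) : x * realExpQuotient x = 1 - Real.exp (-x) := by
  unfold realExpQuotient
  split_ifs with h
  · simp [h]
  · field_simp

lemma analyticAt_expQuotient : AnalyticAt ℂ expQuotient 0 := by
  have h : AnalyticAt ℂ (fun z : ℂ => 1 - Complex.exp (-z)) 0 := by fun_prop
  have hd : HasDerivAt (fun z : ℂ => 1 - Complex.exp (-z)) 1 0 := by
    simpa using ((hasDerivAt_neg (0 : ℂ)).cexp).const_sub 1
  convert! analyticAt_ite_div h (by simp) hd.deriv using 1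

lemma analyticAt_realExpQuotient : AnalyticAt ℝ realExpQuotient 0 := by
  have h : AnalyticAt ℝ (fun z : ℝ => 1 - Real.exp (-z)) 0 := by fun_prop
  have hd : HasDerivAt (fun z : ℝ => 1 - Real.exp (-z)) 1 0 := by
    simpa using ((hasDerivAt_neg (0 : ℝ)).exp).const_sub 1
  convert! analyticAt_ite_div h (by simp) hd.deriv using 1

lemma iteratedDeriv_cexp_neg (n : ℕ) :
    iteratedDeriv n (fun z : ℂ => Complex.exp (-z)) 0 = (-1) ^ n := by
  have := iteratedDeriv_cexp_const_mul n (-1)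
  simpa using congrFun this 0

lemma iteratedDeriv_rexp_neg (n : ℕ) :
    iteratedDeriv n (fun z : ℝ => Real.exp (-z)) 0 = (-1) ^ n := by
  have := iteratedDeriv_exp_const_mul n (-1)
  simpa using congrFun this 0

lemma expQuotient_zero : expQuotient 0 = 1 := by simp [expQuotient]

lemma realExpQuotient_zero : realExpQuotient 0 = 1 := by simp [realExpQuotient]

/-- The function `((1 - e^(-z)) / z)^α e^(p z)` on `ℂ`. -/
def complexExpansion (α p z : ℂ) : ℂ := expQuotient z ^ α * Complex.exp (p * z)

lemma analyticAt_complexExpansion (α p : ℂ) : AnalyticAt ℂ (complexExpansion α p) 0 := by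
  unfold complexExpansion
  refine (analyticAt_expQuotient.cpow analyticAt_const ?_).mul (by fun_prop)
  simp [expQuotient_zero]

lemma iteratedDeriv_complexExpansion (α p : ℂ) {l : ℕ} (hl : l < 5) :
    iteratedDeriv l (complexExpansion α p) 0 = l.factorial * taylorCoeff α p l := by
  refine iteratedDeriv_eq_taylorCoeff analyticAt_expQuotient (analyticAt_complexExpansion α p)
    (iteratedDeriv_of_mul_eq_one_sub analyticAt_expQuotient
      (e := fun z : ℂ => Complex.exp (-z)) (by fun_prop)
      (Eventually.of_forall mul_expQuotient) iteratedDeriv_cexp_neg)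
    (by simp [complexExpansion, expQuotient_zero]) ?_ hl
  have hs : ∀ᶠ z in 𝓝 (0 : ℂ), expQuotient z ∈ Complex.slitPlane :=
    analyticAt_expQuotient.continuousAt.eventually_mem
      (Complex.isOpen_slitPlane.mem_nhds (by simp [expQuotient_zero]))
  filter_upwards [hs, analyticAt_expQuotient.eventually_analyticAt] with z hz ha
  have h1 := (ha.differentiableAt.hasDerivAt.cpow_const (c := α) hz).mul
    (((hasDerivAt_id z).const_mul p).cexp)
  have h2 : deriv (complexExpansion α p) z = _ := h1.deriv
  have hne : expQuotient z ≠ 0 := Complex.slitPlane_ne_zero hz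
  rw [h2, complexExpansion, Complex.cpow_sub _ _ hne, Complex.cpow_one]
  simp only [id]
  field_simp

lemma expansionFunction_eq (α : ℝ) (p : ℤ) :
    expansionFunction α p = fun x => realExpQuotient x ^ α * Real.exp ((p : ℝ) * x) := rfl

lemma eventually_realExpQuotient_pos : ∀ᶠ z in 𝓝 (0 : ℝ), 0 < realExpQuotient z :=
  analyticAt_realExpQuotient.continuousAt.eventually_mem
    (isOpen_Ioi.mem_nhds (by simp [realExpQuotient_zero]))

lemma analyticAt_expansionFunction (α : ℝ) (p : ℤ) : AnalyticAt ℝ (expansionFunction α p) 0 := by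
  rw [expansionFunction_eq]
  refine AnalyticAt.fun_mul ?_ (by fun_prop)
  have h : AnalyticAt ℝ (fun x => Real.exp (Real.log (realExpQuotient x) * α)) 0 :=
    ((analyticAt_realExpQuotient.log (by simp [realExpQuotient_zero])).mul analyticAt_const).rexp'
  refine h.congr ?_
  filter_upwards [eventually_realExpQuotient_pos] with x hx
  rw [Real.rpow_def_of_pos hx]

lemma expansionCoeff_eq (α : ℝ) (p : ℤ) {l : ℕ} (hl : l < 5) :
    expansionCoeff α p l = taylorCoeff α (p : ℝ) l := by
  have : iteratedDeriv l (expansionFunction α p) 0 = l.factorial * taylorCoeff α (p : ℝ) l := by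
    refine iteratedDeriv_eq_taylorCoeff analyticAt_realExpQuotient
      (analyticAt_expansionFunction α p)
      (iteratedDeriv_of_mul_eq_one_sub analyticAt_realExpQuotient
        (e := fun z : ℝ => Real.exp (-z)) (by fun_prop)
        (Eventually.of_forall mul_realExpQuotient) iteratedDeriv_rexp_neg)
      (by simp [expansionFunction]) ?_ hl
    filter_upwards [eventually_realExpQuotient_pos,
      analyticAt_realExpQuotient.eventually_analyticAt] with z hz ha
    have h1 := (ha.differentiableAt.hasDerivAt.rpow_const (p := α) (Or.inl hz.ne')).mul
      (((hasDerivAt_id z).const_mul (p : ℝ)).exp)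
    have h2 : deriv (expansionFunction α p) z = _ := h1.deriv
    rw [h2, expansionFunction_eq, Real.rpow_sub hz, Real.rpow_one]
    simp only [id]
    field_simp
  rw [expansionCoeff, this]
  field_simp

/-! ### The linear system for the weights. -/

lemma muZero_eq (α : ℝ) :
    muZero α = 2 * (862 + α - 285 * α ^ 2 + 15 * α ^ 3 + 15 * α ^ 4) / denom α := by
  have : denom α = 2 * (862 - α - 285 * α ^ 2 - 15 * α ^ 3 + 15 * α ^ 4) := by
    unfold denom; ring
  rw [muZero, this, mul_div_mul_left _ _ two_ne_zero]

lemma coefficientSystem_solution {α : ℝ} (hd : denom α ≠ 0) :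
    CoefficientSystem α (gammaOne α) (gammaTwo α) (muOne α) (muZero α) (muNegOne α) := by
  simp only [CoefficientSystem, expansionCoeff_eq, Nat.reduceLT, taylorCoeff, muZero_eq, gammaOne,
    gammaTwo, muOne, muNegOne]
  push_cast
  refine ⟨?_, ?_, ?_, ?_, ?_⟩ <;> field_simp <;> unfold denom <;> ring

lemma coefficientSystem_iff {α : ℝ} (hα : α ≠ 0) (hd : denom α ≠ 0) (g₁ g₂ m₁ m₀ m₂ : ℝ) :
    CoefficientSystem α g₁ g₂ m₁ m₀ m₂ ↔
      g₁ = gammaOne α ∧ g₂ = gammaTwo α ∧ m₁ = muOne α ∧ m₀ = muZero α ∧ m₂ = muNegOne α := by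
  refine ⟨fun hs => ?_, ?_⟩
  swap
  · rintro ⟨rfl, rfl, rfl, rfl, rfl⟩
    exact coefficientSystem_solution hd
  have ht := coefficientSystem_solution hd
  simp only [CoefficientSystem, expansionCoeff_eq, Nat.reduceLT, taylorCoeff] at hs ht
  push_cast at hs ht
  obtain ⟨h0, h1, h2, h3, h4⟩ := hs
  obtain ⟨k0, k1, k2, k3, k4⟩ := ht
  generalize gammaOne α = g₁' at *
  generalize gammaTwo α = g₂' at *
  generalize muOne α = m₁' at *
  generalize muZero α = m₀' at *
  generalize muNegOne α = m₂' at *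
  set t : ℝ → ℕ → ℝ := fun p l => taylorCoeff (-α) p l with ht
  -- the differences of the two solutions, after division by the power series for the shift `0`
  have d0 : (m₁ - m₁') + (m₀ - m₀') + (m₂ - m₂') = (g₁ - g₁') + (g₂ - g₂') := by
    linear_combination h0 - k0
  have d1 : (m₁ - m₁') - (m₂ - m₂') = (g₁ - g₁') * t (-1) 1 + (g₂ - g₂') * t 1 1 := by
    simp only [ht, taylorCoeff]
    linear_combination (α / 2) * (h0 - k0) + (h1 - k1)
  have d2 : ((m₁ - m₁') + (m₂ - m₂')) / 2 = (g₁ - g₁') * t (-1) 2 + (g₂ - g₂') * t 1 2 := by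
    simp only [ht, taylorCoeff]
    linear_combination ((α / 2) ^ 2 / 2 - α / 24) * (h0 - k0) + (α / 2) * (h1 - k1) + (h2 - k2)
  have d3 : ((m₁ - m₁') - (m₂ - m₂')) / 6 = (g₁ - g₁') * t (-1) 3 + (g₂ - g₂') * t 1 3 := by
    simp only [ht, taylorCoeff]
    linear_combination ((α / 2) ^ 3 / 6 - (α / 2) * α / 24) * (h0 - k0) + ((α / 2) ^ 2 / 2 - α / 24) * (h1 - k1) + (α / 2) * (h2 - k2) + (h3 - k3)
  have d4 : ((m₁ - m₁') + (m₂ - m₂')) / 24 = (g₁ - g₁') * t (-1) 4 + (g₂ - g₂') * t 1 4 := by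
    simp only [ht, taylorCoeff]
    linear_combination ((α / 2) ^ 4 / 24 - (α / 2) ^ 2 * α / 48 + α ^ 2 / 1152 + α / 2880) * (h0 - k0) + ((α / 2) ^ 3 / 6 - (α / 2) * α / 24) * (h1 - k1) + ((α / 2) ^ 2 / 2 - α / 24) * (h2 - k2)
      + (α / 2) * (h3 - k3) + (h4 - k4)
  -- After the division, the `m` side is `m₁ e^z + m₀ + m₂ e^(-z)`, so its odd coefficients are
  -- proportional to `m₁ - m₂` and its even ones of positive order to `m₁ + m₂`. These two
  -- combinations eliminate the `m`'s.
  have e3 : (g₁ - g₁') * (6 * t (-1) 3 - t (-1) 1) + (g₂ - g₂') * (6 * t 1 3 - t 1 1) = 0 := by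
    linear_combination d1 - 6 * d3
  have e4 : (g₁ - g₁') * (24 * t (-1) 4 - 2 * t (-1) 2)
      + (g₂ - g₂') * (24 * t 1 4 - 2 * t 1 2) = 0 := by
    linear_combination 2 * d2 - 24 * d4
  have hdet : (6 * t (-1) 3 - t (-1) 1) * (24 * t 1 4 - 2 * t 1 2) -
      (24 * t (-1) 4 - 2 * t (-1) 2) * (6 * t 1 3 - t 1 1) = (1 / 960) * α ^ 2 * denom α := by
    simp only [ht, taylorCoeff, denom]
    ring
  have hne : (1 / 960) * α ^ 2 * denom α ≠ 0 := by positivity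
  have hg1 : g₁ - g₁' = 0 := by
    have : (g₁ - g₁') * ((1 / 960) * α ^ 2 * denom α) = 0 := by
      rw [← hdet]
      linear_combination (24 * t 1 4 - 2 * t 1 2) * e3 - (6 * t 1 3 - t 1 1) * e4
    exact (mul_eq_zero.mp this).resolve_right hne
  have hg2 : g₂ - g₂' = 0 := by
    have : (g₂ - g₂') * ((1 / 960) * α ^ 2 * denom α) = 0 := by
      rw [← hdet]
      linear_combination (6 * t (-1) 3 - t (-1) 1) * e4 - (24 * t (-1) 4 - 2 * t (-1) 2) * e3
    exact (mul_eq_zero.mp this).resolve_right hne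
  rw [hg1, hg2] at d0 d1 d2
  refine ⟨by linarith, by linarith, by linarith, by linarith, by linarith⟩

/-! ### The symbol error on the imaginary axis. -/

/-- The symbol of the difference of the two sides of the scheme, divided by `z ^ α`. -/
def scaledSymbolError (α : ℝ) (z : ℂ) : ℂ :=
  gammaOne α * Complex.exp (-1 * z) + Complex.exp (0 * z) + gammaTwo α * Complex.exp (1 * z) -
    (muOne α * complexExpansion α 1 z + muZero α * complexExpansion α 0 z +
      muNegOne α * complexExpansion α (-1) z)

/-- The symbol of the difference of the two sides of the scheme. -/
def symbolError (α : ℝ) (z : ℂ) : ℂ :=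
  z ^ (α : ℂ) * (gammaOne α * Complex.exp (-z) + 1 + gammaTwo α * Complex.exp z) -
    (1 - Complex.exp (-z)) ^ (α : ℂ) *
      (muOne α * Complex.exp z + muZero α + muNegOne α * Complex.exp (-z))

/-- The derivative of order `l` is, up to sign, `l!` times the `l`-th equation of the system. -/
lemma iteratedDeriv_scaledSymbolError {α : ℝ} (hd : denom α ≠ 0) {l : ℕ} (hl : l < 5) :
    iteratedDeriv l (scaledSymbolError α) 0 = 0 := by
  have he : ∀ c : ℂ, AnalyticAt ℂ (fun z : ℂ => Complex.exp (c * z)) 0 := fun c => by fun_prop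
  have hE : ∀ k c : ℂ, AnalyticAt ℂ (fun z : ℂ => k * Complex.exp (c * z)) 0 :=
    fun k c => by fun_prop
  have hm : ∀ c p : ℂ, AnalyticAt ℂ (fun z : ℂ => c * complexExpansion α p z) 0 := fun c p =>
    analyticAt_const.mul (analyticAt_complexExpansion α p)
  have hed : ∀ c : ℂ, iteratedDeriv l (fun z : ℂ => Complex.exp (c * z)) 0 = c ^ l := fun c => by
    simp [iteratedDeriv_cexp_const_mul]
  have key : iteratedDeriv l (scaledSymbolError α) 0 =
      gammaOne α * (-1) ^ l + 0 ^ l + gammaTwo α * 1 ^ l -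
        (muOne α * (l.factorial * taylorCoeff (α : ℂ) 1 l) +
          muZero α * (l.factorial * taylorCoeff (α : ℂ) 0 l) +
          muNegOne α * (l.factorial * taylorCoeff (α : ℂ) (-1) l)) := by
    unfold scaledSymbolError
    rw [iteratedDeriv_fun_sub
        (((hE _ _).fun_add (he _)).fun_add (hE _ _)).contDiffAt
        (((hm _ _).fun_add (hm _ _)).fun_add (hm _ _)).contDiffAt,
      iteratedDeriv_fun_add ((hE _ _).fun_add (he _)).contDiffAt (hE _ _).contDiffAt,
      iteratedDeriv_fun_add (hE _ _).contDiffAt (he _).contDiffAt,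
      iteratedDeriv_fun_add ((hm _ _).fun_add (hm _ _)).contDiffAt (hm _ _).contDiffAt,
      iteratedDeriv_fun_add (hm _ _).contDiffAt (hm _ _).contDiffAt]
    simp only [iteratedDeriv_const_mul_field, hed, iteratedDeriv_complexExpansion _ _ hl]
  rw [key]
  have hs := coefficientSystem_solution hd
  simp only [CoefficientSystem, expansionCoeff_eq, Nat.reduceLT, taylorCoeff] at hs
  obtain ⟨h0, h1, h2, h3, h4⟩ := hs
  replace h0 := congrArg ((↑) : ℝ → ℂ) h0
  replace h1 := congrArg ((↑) : ℝ → ℂ) h1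
  replace h2 := congrArg ((↑) : ℝ → ℂ) h2
  replace h3 := congrArg ((↑) : ℝ → ℂ) h3
  replace h4 := congrArg ((↑) : ℝ → ℂ) h4
  push_cast at h0 h1 h2 h3 h4
  interval_cases l <;> simp only [taylorCoeff, Nat.factorial] <;> push_cast
  · linear_combination -h0
  · linear_combination -h1
  · linear_combination -2 * h2
  · linear_combination -6 * h3
  · linear_combination -24 * h4

lemma exists_norm_scaledSymbolError_le {α : ℝ} (hd : denom α ≠ 0) :
    ∃ C > 0, ∀ᶠ z in 𝓝 (0 : ℂ), ‖scaledSymbolError α z‖ ≤ C * ‖z‖ ^ 5 := by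
  have ha : AnalyticAt ℂ (scaledSymbolError α) 0 := by
    have hm : ∀ c p : ℂ, AnalyticAt ℂ (fun z : ℂ => c * complexExpansion α p z) 0 := fun c p =>
      analyticAt_const.mul (analyticAt_complexExpansion α p)
    exact AnalyticAt.sub (f := fun z : ℂ => gammaOne α * Complex.exp (-1 * z) +
      Complex.exp (0 * z) + gammaTwo α * Complex.exp (1 * z)) (by fun_prop)
      (((hm _ _).add (hm _ _)).add (hm _ _))
  have ho := (natCast_le_analyticOrderAt_iff_iteratedDeriv_eq_zero (n := 5) ha).mpr
    fun i hi => iteratedDeriv_scaledSymbolError hd hi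
  obtain ⟨g, hg, hgz⟩ := (natCast_le_analyticOrderAt ha).mp ho
  refine ⟨‖g 0‖ + 1, by positivity, ?_⟩
  filter_upwards [hgz, hg.continuousAt.norm.eventually_lt_const (lt_add_one ‖g 0‖)] with z hz hb
  rw [hz, smul_eq_mul, sub_zero, norm_mul, norm_pow, mul_comm]
  gcongr

/-- With principal branches, `(z b)^α = z^α b^α` requires the arguments to add up within `(-π, π]`.
Here `|arg z| ≤ π/2` and `|arg b| < π/2`, the latter because `b = expQuotient z` has positive real
part. -/
lemma symbolError_eq {α : ℝ} {z : ℂ} (hz : z ≠ 0) (hre : z.re = 0)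
    (hb : 0 < (expQuotient z).re) :
    symbolError α z = z ^ (α : ℂ) * scaledSymbolError α z := by
  have hb0 : expQuotient z ≠ 0 := fun h => by simp [h] at hb
  have h1 : |z.arg| ≤ Real.pi / 2 := Complex.abs_arg_le_pi_div_two_iff.mpr hre.ge
  have h2 : |(expQuotient z).arg| < Real.pi / 2 :=
    Complex.abs_arg_lt_pi_div_two_iff.mpr (Or.inl hb)
  have h3 : (1 - Complex.exp (-z)) ^ (α : ℂ) = z ^ (α : ℂ) * expQuotient z ^ (α : ℂ) := by
    rw [← mul_expQuotient, Complex.cpow_def_of_ne_zero (mul_ne_zero hz hb0),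
      Complex.cpow_def_of_ne_zero hz, Complex.cpow_def_of_ne_zero hb0, ← Complex.exp_add,
      (Complex.log_mul_eq_add_log_iff hz hb0).mpr, add_mul]
    rw [abs_le] at h1
    rw [abs_lt] at h2
    constructor <;> linarith
  simp only [symbolError, scaledSymbolError, complexExpansion, h3]
  simp only [one_mul, zero_mul, Complex.exp_zero, neg_mul]
  ring

/-- The symbol error is of fifth order relative to `|z| ^ α` on the imaginary axis. -/
lemma exists_norm_symbolError_le {α : ℝ} (hα : 0 < α) (hd : denom α ≠ 0) :
    ∃ C : ℝ, ∀ z : ℂ, z.re = 0 → ‖symbolError α z‖ ≤ C * ‖z‖ ^ (5 + α) := by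
  obtain ⟨C, hC, hev⟩ := exists_norm_scaledSymbolError_le hd
  have hb : ∀ᶠ z in 𝓝 (0 : ℂ), 0 < (expQuotient z).re :=
    (Complex.continuous_re.continuousAt.comp analyticAt_expQuotient.continuousAt).eventually_mem
      (isOpen_Ioi.mem_nhds (by simp [expQuotient_zero]))
  obtain ⟨r, hr, hball⟩ := Metric.eventually_nhds_iff.mp (hev.and hb)
  set G : ℝ := |gammaOne α| + 1 + |gammaTwo α|
  set M : ℝ := |muOne α| + |muZero α| + |muNegOne α|
  have hG : 0 ≤ G := by positivity
  have hM : 0 ≤ M := by positivity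
  -- Inside the ball of radius `r` the Taylor bound `C` applies. Outside, the error is at most `G
  -- ‖z‖^α + 2^α M`, and each term is raised to order `5 + α` by a power of `‖z‖ / r ≥ 1`.
  refine ⟨C + (G / r ^ (5 : ℝ) + 2 ^ α * M / r ^ (5 + α)), fun z hre => ?_⟩
  by_cases hz : z = 0
  · have h5 : (5 + α) ≠ 0 := by positivity
    simp [symbolError, hz, hα.ne', Real.zero_rpow h5]
  have hzp : 0 < ‖z‖ := norm_pos_iff.mpr hz
  have hsplit : ‖z‖ ^ (5 + α) = ‖z‖ ^ α * ‖z‖ ^ 5 := by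
    rw [add_comm, Real.rpow_add hzp]; norm_cast
  have hzα : ‖z ^ (α : ℂ)‖ = ‖z‖ ^ α := Complex.norm_cpow_real z α
  by_cases hzr : ‖z‖ < r
  · obtain ⟨h1, h2⟩ := hball (by simpa using hzr : dist z 0 < r)
    rw [symbolError_eq hz hre h2, norm_mul, hzα]
    calc ‖z‖ ^ α * ‖scaledSymbolError α z‖ ≤ ‖z‖ ^ α * (C * ‖z‖ ^ 5) := by gcongr
      _ = C * ‖z‖ ^ (5 + α) := by rw [hsplit]; ring
      _ ≤ _ := by
        gcongr
        exact le_add_of_nonneg_right (by positivity)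
  · push Not at hzr
    have e1 : ‖Complex.exp z‖ = 1 := by rw [Complex.norm_exp, hre, Real.exp_zero]
    have e2 : ‖Complex.exp (-z)‖ = 1 := by
      rw [Complex.norm_exp, Complex.neg_re, hre, neg_zero, Real.exp_zero]
    have n1 : ‖(gammaOne α * Complex.exp (-z) + 1 + gammaTwo α * Complex.exp z : ℂ)‖ ≤ G := by
      refine norm_add₃_le.trans ?_
      simp [e1, e2, G]
    have n2 : ‖(muOne α * Complex.exp z + muZero α + muNegOne α * Complex.exp (-z) : ℂ)‖ ≤ M := by
      refine norm_add₃_le.trans ?_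
      simp [e1, e2, M]
    have n3 : ‖(1 - Complex.exp (-z)) ^ (α : ℂ)‖ ≤ 2 ^ α := by
      rw [Complex.norm_cpow_real]
      refine Real.rpow_le_rpow (norm_nonneg _) ?_ hα.le
      refine (norm_sub_le _ _).trans ?_
      rw [e2]; norm_num
    have hq : 1 ≤ ‖z‖ ^ (5 : ℝ) / r ^ (5 : ℝ) := by
      rw [one_le_div (by positivity)]
      exact Real.rpow_le_rpow hr.le hzr (by norm_num)
    have hq' : 1 ≤ ‖z‖ ^ (5 + α) / r ^ (5 + α) := by
      rw [one_le_div (by positivity)]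
      exact Real.rpow_le_rpow hr.le hzr (by positivity)
    calc ‖symbolError α z‖ ≤ ‖z‖ ^ α * G + 2 ^ α * M := by
          refine (norm_sub_le _ _).trans ?_
          rw [norm_mul, norm_mul, hzα]
          gcongr
      _ ≤ ‖z‖ ^ α * G * (‖z‖ ^ (5 : ℝ) / r ^ (5 : ℝ))
          + 2 ^ α * M * (‖z‖ ^ (5 + α) / r ^ (5 + α)) := by
          exact add_le_add (le_mul_of_one_le_right (by positivity) hq)
            (le_mul_of_one_le_right (by positivity) hq')
      _ = (G / r ^ (5 : ℝ) + 2 ^ α * M / r ^ (5 + α)) * ‖z‖ ^ (5 + α) := by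
          rw [add_comm 5 α, Real.rpow_add hzp]; ring
      _ ≤ _ := by
          exact mul_le_mul_of_nonneg_right (le_add_of_nonneg_left hC.le) (by positivity)

/-! ### Grünwald weights and their generating function. -/

lemma grunwaldWeight_zero {α : ℝ} (hα : ∀ k : ℕ, α ≠ k) : grunwaldWeight α 0 = 1 := by
  have : Real.Gamma (-α) ≠ 0 := Real.Gamma_ne_zero fun m h => hα m (neg_injective h)
  simp [grunwaldWeight, this]

lemma grunwaldWeight_succ {α : ℝ} (hα : ∀ k : ℕ, α ≠ k) (k : ℕ) :
    grunwaldWeight α (k + 1) = grunwaldWeight α k * ((k - α) / (k + 1)) := by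
  have h1 : (k : ℝ) - α ≠ 0 := sub_ne_zero.mpr (hα k).symm
  have h2 : (k : ℝ) + 1 ≠ 0 := by positivity
  simp only [grunwaldWeight]
  push_cast
  rw [show (k : ℝ) + 1 - α = (k - α) + 1 by ring, Real.Gamma_add_one h1, Real.Gamma_add_one h2]
  have h3 : Real.Gamma ((k : ℝ) + 1) ≠ 0 := (Real.Gamma_pos_of_pos (by positivity)).ne'
  have : Real.Gamma (-α) ≠ 0 := Real.Gamma_ne_zero fun m h => hα m (neg_injective h)
  field_simp

lemma sum_grunwaldWeight {α : ℝ} (hα : ∀ k : ℕ, α ≠ k) (n : ℕ) :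
    ∑ k ∈ Finset.range (n + 1), grunwaldWeight α k
      = grunwaldWeight α n * ((n - α) / (-α)) := by
  have h0 : α ≠ 0 := by simpa using hα 0
  induction n with
  | zero => simp [h0]
  | succ n ih =>
    rw [Finset.sum_range_succ, ih, grunwaldWeight_succ hα]
    push_cast
    field_simp
    ring

lemma ne_natCast_of_mem_Ioo {α : ℝ} (h1 : 1 < α) (h2 : α < 2) (k : ℕ) : α ≠ k := by
  rintro rfl
  have h1' : 1 < k := by exact_mod_cast h1
  have h2' : k < 2 := by exact_mod_cast h2
  omega

lemma grunwaldWeight_add_two_nonneg {α : ℝ} (h1 : 1 < α) (h2 : α < 2) (k : ℕ) :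
    0 ≤ grunwaldWeight α (k + 2) := by
  have hα := ne_natCast_of_mem_Ioo h1 h2
  induction k with
  | zero =>
    rw [grunwaldWeight_succ hα, grunwaldWeight_succ hα 0, grunwaldWeight_zero hα]
    norm_num
    nlinarith
  | succ k ih =>
    rw [show k + 1 + 2 = (k + 2) + 1 by ring, grunwaldWeight_succ hα]
    refine mul_nonneg ih (div_nonneg ?_ (by positivity))
    push_cast
    have : (0 : ℝ) ≤ k := k.cast_nonneg
    linarith

/-- From index `2` on the weights are nonnegative. The closed form of the partial sums makes them
nonpositive, so the tail sums are at most `-(g₀ + g₁) = α - 1`. -/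
lemma summable_grunwaldWeight {α : ℝ} (h1 : 1 < α) (h2 : α < 2) :
    Summable (grunwaldWeight α) := by
  have hα := ne_natCast_of_mem_Ioo h1 h2
  rw [← summable_nat_add_iff 2]
  refine summable_of_sum_range_le (c := α - 1) (grunwaldWeight_add_two_nonneg h1 h2) fun n => ?_
  have hs := Finset.sum_range_add (grunwaldWeight α) 2 n
  have hle : ∑ k ∈ Finset.range (2 + n), grunwaldWeight α k ≤ 0 := by
    cases n with
    | zero =>
      simp [Finset.sum_range_succ, grunwaldWeight_succ hα, grunwaldWeight_zero hα]
      linarith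
    | succ n =>
      rw [show 2 + (n + 1) = (n + 2) + 1 by ring, sum_grunwaldWeight hα]
      refine mul_nonpos_of_nonneg_of_nonpos (grunwaldWeight_add_two_nonneg h1 h2 n) ?_
      refine div_nonpos_of_nonneg_of_nonpos ?_ (by linarith)
      push_cast
      have : (0 : ℝ) ≤ n := n.cast_nonneg
      linarith
  have h01 : ∑ k ∈ Finset.range 2, grunwaldWeight α k = 1 - α := by
    simp [Finset.sum_range_succ, grunwaldWeight_succ hα, grunwaldWeight_zero hα]
    ring
  simp only [add_comm _ 2]
  linarith

lemma ofReal_grunwaldWeight_eq_choose {α : ℝ} (hα : ∀ k : ℕ, α ≠ k) (k : ℕ) :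
    (grunwaldWeight α k : ℂ) = (-1) ^ k * Ring.choose (α : ℂ) k := by
  induction k with
  | zero => simp [grunwaldWeight_zero hα]
  | succ k ih =>
    have hk : ((k : ℂ) + 1) ≠ 0 := by exact_mod_cast k.succ_ne_zero
    have hf : (k.factorial : ℂ) ≠ 0 := by exact_mod_cast k.factorial_ne_zero
    rw [grunwaldWeight_succ hα]
    push_cast
    rw [ih]
    simp only [Ring.choose_eq_smul, descPochhammer_succ_right, Polynomial.smeval_mul,
      Polynomial.smeval_sub, Polynomial.smeval_X, Polynomial.smeval_natCast, Nat.factorial_succ,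
      smul_eq_mul]
    push_cast
    simp only [nsmul_eq_mul, pow_zero, pow_one, mul_one]
    field_simp
    ring

/-- Inside the disc this is the binomial series. The scheme needs `‖w‖ = 1`, which Abel's theorem
reaches along radii; continuity of the power at `1 - w` holds even at `0`, since `α > 0`. -/
lemma tsum_grunwaldWeight_mul_pow {α : ℝ} (h1 : 1 < α) (h2 : α < 2) {w : ℂ} (hw : ‖w‖ ≤ 1) :
    ∑' k : ℕ, (grunwaldWeight α k : ℂ) * w ^ k = (1 - w) ^ (α : ℂ) := by
  have hα := ne_natCast_of_mem_Ioo h1 h2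
  have hsum : Summable fun k : ℕ => (grunwaldWeight α k : ℂ) * w ^ k := by
    refine Summable.of_norm_bounded (summable_grunwaldWeight h1 h2).norm fun k => ?_
    rw [norm_mul, norm_pow, Complex.norm_real]
    exact mul_le_of_le_one_right (norm_nonneg _) (pow_le_one₀ (norm_nonneg _) hw)
  have habel := Complex.tendsto_tsum_powerSeries_nhdsWithin_lt hsum.hasSum.tendsto_sum_nat
  rw [tendsto_map'_iff] at habel
  have hin : ∀ᶠ r : ℝ in 𝓝[<] 1, (1 - w * r) ^ (α : ℂ) =
      ∑' k : ℕ, (grunwaldWeight α k : ℂ) * w ^ k * (r : ℂ) ^ k := by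
    filter_upwards [Ioo_mem_nhdsLT zero_lt_one] with r hr
    have hr1 : ‖-(w * r)‖ < 1 := by
      rw [norm_neg, norm_mul, Complex.norm_real, Real.norm_of_nonneg hr.1.le]
      exact lt_of_le_of_lt (mul_le_of_le_one_left hr.1.le hw) hr.2
    have := (Complex.one_add_cpow_hasFPowerSeriesOnBall_zero (a := (α : ℂ))).hasSum
      (y := -(w * r)) (by rwa [← ENNReal.ofReal_one, Metric.eball_ofReal, mem_ball_zero_iff])
    have h3 := this.tsum_eq
    simp only [zero_add] at h3
    rw [sub_eq_add_neg, ← h3]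
    congr 1
    ext k
    rw [binomialSeries_apply, ofReal_grunwaldWeight_eq_choose hα]
    simp
    rw [neg_pow, mul_pow]
    ring
  have hlim : Tendsto (fun r : ℝ => (1 - w * r) ^ (α : ℂ)) (𝓝[<] 1) (𝓝 ((1 - w) ^ (α : ℂ))) := by
    have hc : ContinuousAt (fun x : ℂ => x ^ (α : ℂ)) (1 - w) := by
      refine Complex.continuousAt_cpow_const_of_re_pos (Or.inl ?_) (by simpa using by linarith)
      have := (Complex.re_le_norm w).trans hw
      simpa using this
    have hl : Tendsto (fun r : ℝ => 1 - w * (r : ℂ)) (𝓝[<] 1) (𝓝 (1 - w)) := by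
      have : Continuous fun r : ℝ => 1 - w * (r : ℂ) := by fun_prop
      have h := this.tendsto 1
      simp only [Complex.ofReal_one, mul_one] at h
      exact h.mono_left nhdsWithin_le_nhds
    exact hc.tendsto.comp hl
  exact tendsto_nhds_unique habel (hlim.congr' hin)

/-! ### Laplace transform of a power in the right half-plane. -/

lemma integrableOn_rpow_mul_exp_neg_mul {a r : ℝ} (ha : 0 < a) (hr : 0 < r) :
    IntegrableOn (fun t : ℝ => t ^ (a - 1) * Real.exp (-(r * t))) (Ioi 0) := by
  have := integrableOn_rpow_mul_exp_neg_mul_rpow (p := 1) (s := a - 1) (b := r)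
    (by linarith) zero_lt_one hr
  simpa using this

lemma integrableOn_laplace_rpow {a : ℝ} (ha : 0 < a) {r : ℂ} (hr : 0 < r.re) :
    IntegrableOn (fun t : ℝ => ((t ^ (a - 1) : ℝ) : ℂ) * Complex.exp (-(r * t))) (Ioi 0) := by
  refine Integrable.mono' (integrableOn_rpow_mul_exp_neg_mul ha hr) ?_ ?_
  · exact Measurable.aestronglyMeasurable (by fun_prop)
  · filter_upwards [ae_restrict_mem measurableSet_Ioi] with t ht
    have : (0 : ℝ) ≤ t ^ (a - 1) := Real.rpow_nonneg (le_of_lt ht) _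
    rw [norm_mul, Complex.norm_real, Real.norm_of_nonneg this, Complex.norm_exp]
    simp

lemma hasDerivAt_laplace_rpow {a : ℝ} (ha : 0 < a) {r : ℂ} (hr : 0 < r.re) :
    HasDerivAt (fun r : ℂ => ∫ t in Ioi (0 : ℝ), ((t ^ (a - 1) : ℝ) : ℂ) * Complex.exp (-(r * t)))
      (∫ t in Ioi (0 : ℝ), ((t ^ (a - 1) : ℝ) : ℂ) * (Complex.exp (-(r * t)) * -t)) r := by
  have hε : 0 < r.re / 2 := by positivity
  refine (hasDerivAt_integral_of_dominated_loc_of_deriv_le (μ := volume.restrict (Ioi 0))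
    (F := fun (r : ℂ) (t : ℝ) => ((t ^ (a - 1) : ℝ) : ℂ) * Complex.exp (-(r * t)))
    (F' := fun (r : ℂ) (t : ℝ) => ((t ^ (a - 1) : ℝ) : ℂ) * (Complex.exp (-(r * t)) * -t))
    -- In the ball of radius `r.re / 2` real parts stay above `r.re / 2`; the factor `t` from
    -- differentiation turns `a` into `a + 1`.
    (bound := fun t : ℝ => t ^ (a + 1 - 1) * Real.exp (-(r.re / 2 * t)))
    (Metric.ball_mem_nhds r hε) ?_ (integrableOn_laplace_rpow ha hr) ?_ ?_
    (integrableOn_rpow_mul_exp_neg_mul (by positivity) hε) ?_).2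
  · exact Eventually.of_forall fun x => Measurable.aestronglyMeasurable (by fun_prop)
  · exact Measurable.aestronglyMeasurable (by fun_prop)
  · filter_upwards [ae_restrict_mem measurableSet_Ioi] with t ht x hx
    have ht' : 0 < t := ht
    have hn : (0 : ℝ) ≤ t ^ (a - 1) := Real.rpow_nonneg ht'.le _
    rw [norm_mul, norm_mul, Complex.norm_real, Real.norm_of_nonneg hn, Complex.norm_exp, norm_neg,
      Complex.norm_real, Real.norm_of_nonneg ht'.le, show a + 1 - 1 = (a - 1) + 1 by ring,
      Real.rpow_add ht', Real.rpow_one]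
    have hx' : r.re / 2 ≤ x.re := by
      have h1 := (Complex.abs_re_le_norm (x - r)).trans (le_of_lt (by simpa [dist_eq_norm] using hx))
      rw [Complex.sub_re, abs_le] at h1
      linarith [h1.1]
    have he : Real.exp (-(x * t : ℂ)).re ≤ Real.exp (-(r.re / 2 * t)) := by
      refine Real.exp_le_exp.mpr ?_
      simp only [Complex.neg_re, Complex.mul_re, Complex.ofReal_re, Complex.ofReal_im, mul_zero,
        sub_zero]
      nlinarith
    calc t ^ (a - 1) * (Real.exp (-(x * t : ℂ)).re * t)
        = t ^ (a - 1) * t * Real.exp (-(x * t : ℂ)).re := by ring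
      _ ≤ _ := by gcongr
  · refine Eventually.of_forall fun t x _ => ?_
    have h := ((hasDerivAt_id x).mul_const (t : ℂ)).neg.cexp.const_mul ((t ^ (a - 1) : ℝ) : ℂ)
    simpa using h

/-- The Laplace transform of `t ^ (a - 1)` on the right half-plane. -/
lemma integral_laplace_rpow {a : ℝ} (ha : 0 < a) {r : ℂ} (hr : 0 < r.re) :
    ∫ t in Ioi (0 : ℝ), ((t ^ (a - 1) : ℝ) : ℂ) * Complex.exp (-(r * t)) =
      Real.Gamma a * r ^ (-a : ℂ) := by
  set U : Set ℂ := {r | 0 < r.re}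
  have hU : IsOpen U := isOpen_lt continuous_const Complex.continuous_re
  have hconv : Convex ℝ U := convex_halfSpace_re_gt 0
  have hF : AnalyticOnNhd ℂ (fun r : ℂ => ∫ t in Ioi (0 : ℝ),
      ((t ^ (a - 1) : ℝ) : ℂ) * Complex.exp (-(r * t))) U :=
    DifferentiableOn.analyticOnNhd (fun r hr =>
      (hasDerivAt_laplace_rpow ha hr).differentiableAt.differentiableWithinAt) hU
  have hG : AnalyticOnNhd ℂ (fun r : ℂ => Real.Gamma a * r ^ (-a : ℂ)) U := fun r hr =>
    analyticAt_const.mul (analyticAt_id.cpow analyticAt_const (Or.inl hr))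
  -- Identity theorem: both sides are analytic and agree on the positive reals, which accumulate at
  -- `1`.
  refine hF.eqOn_of_preconnected_of_frequently_eq hG hconv.isPreconnected
    (z₀ := 1) (by simp [U]) ?_ hr
  have hreal : ∀ x : ℝ, 0 < x → ∫ t in Ioi (0 : ℝ),
      ((t ^ (a - 1) : ℝ) : ℂ) * Complex.exp (-((x : ℂ) * t)) = Real.Gamma a * (x : ℂ) ^ (-a : ℂ) := by
    intro x hx
    calc _ = ((∫ t in Ioi (0 : ℝ), t ^ (a - 1) * Real.exp (-(x * t)) : ℝ) : ℂ) := by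
          rw [← integral_complex_ofReal]
          refine integral_congr_ae (Eventually.of_forall fun t => ?_)
          push_cast
          rfl
      _ = _ := by
          rw [Real.integral_rpow_mul_exp_neg_mul_Ioi ha hx, one_div, Real.inv_rpow hx.le,
            ← Real.rpow_neg hx.le]
          push_cast [Complex.ofReal_cpow hx.le]
          ring
  have hmap : Tendsto (fun x : ℝ => (x : ℂ)) (𝓝[≠] 1) (𝓝[≠] 1) := by
    refine tendsto_nhdsWithin_iff.mpr ⟨?_, ?_⟩
    · have := Complex.continuous_ofReal.tendsto 1
      simpa using this.mono_left nhdsWithin_le_nhds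
    · filter_upwards [self_mem_nhdsWithin] with x hx
      simpa using hx
  refine hmap.frequently (Eventually.frequently ?_)
  filter_upwards [nhdsWithin_le_nhds (Ioi_mem_nhds zero_lt_one)] with x hx
  exact hreal x hx

/-! ### Integrability of powers against the spectral decay. -/

lemma integrableOn_abs_rpow {s : ℝ} (hs : -1 < s) :
    IntegrableOn (fun w : ℝ => |w| ^ s) (Icc (-1) 1) := by
  have h1 : IntervalIntegrable (fun w : ℝ => |w| ^ s) volume 0 1 := by
    refine (intervalIntegral.intervalIntegrable_rpow' hs (a := 0) (b := 1)).congr ?_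
    intro w hw
    rw [uIoc_of_le zero_le_one] at hw
    simp [abs_of_pos hw.1]
  have h2 : IntervalIntegrable (fun w : ℝ => |w| ^ s) volume (-1) 0 := by
    rw [IntervalIntegrable.iff_comp_neg]
    simpa using h1.symm
  rw [integrableOn_Icc_iff_integrableOn_Ioc,
    ← intervalIntegrable_iff_integrableOn_Ioc_of_le (by norm_num)]
  exact h2.trans h1

/-- The condition `-1 < s` serves the origin and `s < 7` serves infinity. The exponent `s = 5 + α`
of the final estimate is what uses the decay of order `8`. -/
lemma integrable_abs_rpow_mul_decay {s : ℝ} (hs : -1 < s) (hs' : s < 7) :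
    Integrable (fun w : ℝ => |w| ^ s * (1 + |w|) ^ (-8 : ℝ)) := by
  set q : ℝ := max s 0 with hq
  have hq7 : q < 7 := max_lt hs' (by norm_num)
  have hi1 : Integrable ((Icc (-1 : ℝ) 1).indicator fun w : ℝ => |w| ^ s) :=
    (integrable_indicator_iff measurableSet_Icc).mpr (integrableOn_abs_rpow hs)
  have hi2 : Integrable fun w : ℝ => (1 + ‖w‖) ^ (-(8 - q)) :=
    integrable_one_add_norm (by simp; linarith)
  refine Integrable.mono' (hi1.add hi2) (Measurable.aestronglyMeasurable (by fun_prop))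
    (Eventually.of_forall fun w => ?_)
  have hw : 0 ≤ |w| := abs_nonneg w
  have hp : 0 ≤ |w| ^ s * (1 + |w|) ^ (-8 : ℝ) := by positivity
  rw [Real.norm_of_nonneg hp, Pi.add_apply]
  by_cases hm : w ∈ Icc (-1 : ℝ) 1
  · rw [indicator_of_mem hm]
    have h1 : (1 + |w|) ^ (-8 : ℝ) ≤ 1 :=
      Real.rpow_le_one_of_one_le_of_nonpos (by linarith) (by norm_num)
    have h2 : 0 ≤ (1 + ‖w‖) ^ (-(8 - q)) := by positivity
    exact (mul_le_of_le_one_right (by positivity) h1).trans (le_add_of_nonneg_right h2)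
  · rw [indicator_of_notMem hm, zero_add]
    have hw1 : 1 ≤ |w| := by
      by_contra! h
      exact hm (abs_le.mp h.le)
    have h1 : |w| ^ s ≤ (1 + |w|) ^ q :=
      (Real.rpow_le_rpow_of_exponent_le hw1 (le_max_left _ _)).trans
        (Real.rpow_le_rpow hw (by linarith) (le_max_right _ _))
    calc |w| ^ s * (1 + |w|) ^ (-8 : ℝ) ≤ (1 + |w|) ^ q * (1 + |w|) ^ (-8 : ℝ) := by gcongr
      _ = (1 + ‖w‖) ^ (-(8 - q)) := by
        rw [← Real.rpow_add (by positivity), Real.norm_eq_abs]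
        congr 1
        ring

/-! ### Spectral representation of `u`. -/

/-- The imaginary frequency `2πiw`. -/
def freq (w : ℝ) : ℂ := 2 * Real.pi * Complex.I * w

lemma freq_re (w : ℝ) : (freq w).re = 0 := by simp [freq]

lemma norm_freq (w : ℝ) : ‖freq w‖ = 2 * Real.pi * |w| := by
  simp [freq, abs_of_pos Real.pi_pos]

lemma freq_ne_zero {w : ℝ} (hw : w ≠ 0) : freq w ≠ 0 := by
  simp [freq, hw, Real.pi_ne_zero]

lemma continuous_freq : Continuous freq := by unfold freq; fun_prop

@[fun_prop]
lemma measurable_freq : Measurable freq := continuous_freq.measurable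

lemma norm_exp_freq_mul (w t : ℝ) : ‖Complex.exp (freq w * t)‖ = 1 := by
  rw [Complex.norm_exp]
  simp [freq_re]

/-- `u` is the inverse Fourier transform of a continuous function decaying like `|w| ^ (-8)`. -/
structure SpectralRepresentation (u : ℝ → ℝ) (V : ℝ → ℂ) (A : ℝ) : Prop where
  continuous : Continuous V
  decay : ∀ w, ‖V w‖ ≤ A * (1 + |w|) ^ (-8 : ℝ)
  eq_integral : ∀ x, (u x : ℂ) = ∫ w, V w * Complex.exp (freq w * x)

namespace SpectralRepresentation

variable {u : ℝ → ℝ} {V : ℝ → ℂ} {A : ℝ}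

lemma integrable_abs_rpow_mul (hV : SpectralRepresentation u V A) {s : ℝ} (hs : -1 < s)
    (hs' : s < 7) : Integrable (fun w : ℝ => |w| ^ s * ‖V w‖) := by
  refine Integrable.mono' ((integrable_abs_rpow_mul_decay hs hs').const_mul A) ?_ ?_
  · exact ((by fun_prop : Measurable fun w : ℝ => |w| ^ s).mul
      hV.continuous.norm.measurable).aestronglyMeasurable
  · refine Eventually.of_forall fun w => ?_
    have h : 0 ≤ |w| ^ s * ‖V w‖ := by positivity
    rw [Real.norm_of_nonneg h]
    calc |w| ^ s * ‖V w‖ ≤ |w| ^ s * (A * (1 + |w|) ^ (-8 : ℝ)) := by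
          gcongr; exact hV.decay w
      _ = _ := by ring

lemma integrable (hV : SpectralRepresentation u V A) : Integrable V := by
  have := hV.integrable_abs_rpow_mul (s := 0) (by norm_num) (by norm_num)
  simp only [Real.rpow_zero, one_mul] at this
  exact (integrable_norm_iff hV.continuous.aestronglyMeasurable).mp this

lemma abs_le (hV : SpectralRepresentation u V A) (x : ℝ) : |u x| ≤ ∫ w, ‖V w‖ := by
  rw [← Real.norm_eq_abs, ← Complex.norm_real, hV.eq_integral]
  refine (norm_integral_le_integral_norm _).trans_eq ?_
  simp [norm_exp_freq_mul]

/-- A multiplier bounded by a power of the frequency preserves integrability. -/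
lemma integrable_mul_of_norm_le (hV : SpectralRepresentation u V A) {s C : ℝ} (hs : -1 < s)
    (hs' : s < 7) {m : ℝ → ℂ} (hm : Measurable m) (hb : ∀ w, ‖m w‖ ≤ C * |w| ^ s) :
    Integrable fun w => V w * m w := by
  refine Integrable.mono' ((hV.integrable_abs_rpow_mul hs hs').const_mul C)
    (hV.continuous.measurable.mul hm).aestronglyMeasurable (Eventually.of_forall fun w => ?_)
  rw [norm_mul]
  calc ‖V w‖ * ‖m w‖ ≤ ‖V w‖ * (C * |w| ^ s) := by gcongr; exact hb w
    _ = _ := by ring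

end SpectralRepresentation

lemma iteratedDeriv_ofReal_comp {f : ℝ → ℝ} {n : ℕ} (hf : ContDiff ℝ n f) :
    iteratedDeriv n (fun x => (f x : ℂ)) = fun x => ((iteratedDeriv n f x : ℝ) : ℂ) := by
  induction n with
  | zero => simp
  | succ n ih =>
    ext x
    have hd : Differentiable ℝ (iteratedDeriv n f) :=
      hf.differentiable_iteratedDeriv n (by exact_mod_cast n.lt_succ_self)
    rw [iteratedDeriv_succ, iteratedDeriv_succ, ih (hf.of_le (by exact_mod_cast n.le_succ))]
    exact (hd x).hasDerivAt.ofReal_comp.deriv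

/-- Fourier inversion for a `C^8` function with integrable derivatives. -/
lemma exists_spectralRepresentation {u : ℝ → ℝ} (hu : ContDiff ℝ 8 u)
    (hint : ∀ k : ℕ, k ≤ 8 → Integrable (iteratedDeriv k u) volume) :
    ∃ V A, SpectralRepresentation u V A := by
  set v : ℝ → ℂ := fun x => (u x : ℂ) with hv
  have hvc : ContDiff ℝ 8 v := Complex.ofRealCLM.contDiff.comp hu
  have hvi : ∀ k : ℕ, k ≤ 8 → Integrable (iteratedDeriv k v) := fun k hk => by
    rw [hv, iteratedDeriv_ofReal_comp (hu.of_le (by exact_mod_cast hk))]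
    exact (hint k hk).ofReal
  have hv0 : Integrable v := by simpa using hvi 0 (by norm_num)
  set V : ℝ → ℂ := FourierTransform.fourier v
  have hVc : Continuous V :=
    VectorFourier.fourierIntegral_continuous Real.continuous_fourierChar
      (by exact continuous_inner) hv0
  have hbd : ∀ (f : ℝ → ℂ) (w : ℝ), ‖FourierTransform.fourier f w‖ ≤ ∫ x, ‖f x‖ := fun f w =>
    VectorFourier.norm_fourierIntegral_le_integral_norm _ _ _ _ _
  set B0 : ℝ := ∫ x, ‖v x‖
  set B8 : ℝ := ∫ x, ‖iteratedDeriv 8 v x‖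
  -- The eighth derivative has transform `(2πiw)^8 V w`, bounded by its `L¹` norm.
  have h8 : ∀ w, |w| ^ 8 * ‖V w‖ ≤ B8 := by
    intro w
    have h := hbd (iteratedDeriv 8 v) w
    rw [Real.fourier_iteratedDeriv (N := 8) (n := 8) (by exact_mod_cast hvc)
      (fun k hk => hvi k (by exact_mod_cast hk)) (by norm_num), norm_smul, norm_pow] at h
    have h2 : ‖(2 * Real.pi * Complex.I * w : ℂ)‖ = 2 * Real.pi * |w| := norm_freq w
    rw [h2] at h
    refine le_trans ?_ h
    gcongr
    have := Real.pi_gt_three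
    nlinarith [abs_nonneg w]
  have hdecay : ∀ w, ‖V w‖ ≤ (2 ^ 7 * (B0 + B8)) * (1 + |w|) ^ (-8 : ℝ) := by
    intro w
    have hp : 0 < 1 + |w| := by positivity
    rw [Real.rpow_neg hp.le, ← div_eq_mul_inv, le_div_iff₀ (by positivity)]
    have h1 : (1 + |w|) ^ (8 : ℝ) ≤ 2 ^ 7 * (1 + |w| ^ 8) := by
      have := add_pow_le (zero_le_one) (abs_nonneg w) 8
      norm_num at this ⊢
      exact_mod_cast this
    calc ‖V w‖ * (1 + |w|) ^ (8 : ℝ) ≤ ‖V w‖ * (2 ^ 7 * (1 + |w| ^ 8)) := by gcongr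
      _ = 2 ^ 7 * (‖V w‖ + |w| ^ 8 * ‖V w‖) := by ring
      _ ≤ _ := by gcongr; exacts [hbd v w, h8 w]
  have hVi : Integrable V := by
    have hd := integrable_abs_rpow_mul_decay (s := 0) (by norm_num) (by norm_num)
    simp only [Real.rpow_zero, one_mul] at hd
    exact Integrable.mono' (hd.const_mul (2 ^ 7 * (B0 + B8))) hVc.aestronglyMeasurable
      (Eventually.of_forall hdecay)
  refine ⟨V, _, hVc, hdecay, fun x => ?_⟩
  have hinv := congrFun (hvc.continuous.fourierInv_fourier_eq hv0 hVi) x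
  rw [← show v x = (u x : ℂ) from rfl, ← hinv, Real.fourierInv_eq']
  refine integral_congr_ae (Eventually.of_forall fun w => ?_)
  simp only [smul_eq_mul, freq]
  rw [mul_comm]
  congr 2
  simp
  ring

/-! ### The Riemann–Liouville derivative as a Fourier multiplier. -/

namespace SpectralRepresentation

variable {u : ℝ → ℝ} {V : ℝ → ℂ} {A : ℝ}

/-- On `(0, 1]` the power is integrable and `u` bounded; beyond `1` the power is at most `1` and `u`
is integrable. -/
lemma integrableOn_rpow_mul_comp_sub (hV : SpectralRepresentation u V A) (hu : Continuous u)
    (hi : Integrable u) {a : ℝ} (ha : 0 < a) (ha' : a < 1) (x : ℝ) :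
    IntegrableOn (fun t : ℝ => t ^ (a - 1) * u (x - t)) (Ioi 0) := by
  rw [← Ioc_union_Ioi_eq_Ioi zero_le_one]
  refine IntegrableOn.union ?_ ?_
  · have h : IntegrableOn (fun t : ℝ => t ^ (a - 1)) (Ioc 0 1) := by
      rw [← intervalIntegrable_iff_integrableOn_Ioc_of_le zero_le_one]
      exact intervalIntegral.intervalIntegrable_rpow' (by linarith)
    exact Integrable.mul_bdd (c := ∫ w, ‖V w‖) h (by fun_prop)
      (Eventually.of_forall fun t => hV.abs_le _)
  · have h : IntegrableOn (fun t : ℝ => u (x - t)) (Ioi 1) := (hi.comp_sub_left x).integrableOn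
    refine Integrable.bdd_mul (c := 1) h (Measurable.aestronglyMeasurable (by fun_prop)) ?_
    filter_upwards [ae_restrict_mem measurableSet_Ioi] with t ht
    have ht1 : (1 : ℝ) < t := ht
    rw [Real.norm_of_nonneg (Real.rpow_nonneg (by linarith) _)]
    exact Real.rpow_le_one_of_one_le_of_nonpos ht1.le (by linarith)

/-- The exponentially damped fractional integral in terms of the spectral density. -/
lemma integral_damped (hV : SpectralRepresentation u V A) {a ε : ℝ} (ha : 0 < a) (hε : 0 < ε)
    (x : ℝ) :
    ∫ t in Ioi (0 : ℝ), ((t ^ (a - 1) * Real.exp (-(ε * t)) * u (x - t) : ℝ) : ℂ) =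
      ∫ w, V w * (Complex.exp (freq w * x) * (Real.Gamma a * (ε + freq w) ^ (-a : ℂ))) := by
  set k : ℝ → ℂ := fun t => ((t ^ (a - 1) * Real.exp (-(ε * t)) : ℝ) : ℂ) with hk
  have hki : Integrable k (volume.restrict (Ioi 0)) :=
    (integrableOn_rpow_mul_exp_neg_mul ha hε).ofReal
  -- The damping `e^(-εt)` makes the kernel integrable, so that Fubini applies; `t ^ (a - 1)` alone
  -- is not integrable at infinity.
  have hprod : Integrable (Function.uncurry fun (t w : ℝ) =>
      Complex.exp (freq w * (x - t : ℝ)) * (k t * V w)) ((volume.restrict (Ioi 0)).prod volume) := by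
    refine Integrable.bdd_mul (c := 1) (hki.mul_prod hV.integrable)
      (Measurable.aestronglyMeasurable ?_) (Eventually.of_forall fun p => ?_)
    · fun_prop
    · exact (norm_exp_freq_mul _ _).le
  calc _ = ∫ t in Ioi (0 : ℝ), ∫ w, Complex.exp (freq w * (x - t : ℝ)) * (k t * V w) := by
        refine integral_congr_ae (Eventually.of_forall fun t => ?_)
        simp only
        rw [Complex.ofReal_mul, hV.eq_integral, ← integral_const_mul]
        refine integral_congr_ae (Eventually.of_forall fun w => ?_)
        simp only [hk]
        ring
    _ = ∫ w, ∫ t in Ioi (0 : ℝ), Complex.exp (freq w * (x - t : ℝ)) * (k t * V w) :=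
        integral_integral_swap hprod
    _ = _ := by
        refine integral_congr_ae (Eventually.of_forall fun w => ?_)
        simp only
        rw [← integral_laplace_rpow ha (r := ε + freq w) (by simpa [freq_re] using hε),
          ← mul_assoc, ← integral_const_mul]
        refine integral_congr_ae (Eventually.of_forall fun t => ?_)
        simp only [hk]
        push_cast
        rw [show freq w * (x - t : ℂ) = freq w * x + -(freq w * t) by ring, Complex.exp_add,
          show -(((ε : ℂ) + freq w) * t) = -(ε * t) + -(freq w * t) by ring, Complex.exp_add]
        ring

/-- Let `ε → 0+` in `integral_damped`, with dominated convergence on both sides. On the spectral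
side `‖ε + freq w‖ ≥ ‖freq w‖` gives the majorant `|w|^(-a) ‖V w‖`, integrable as `a < 1`. -/
lemma integral_rpow_mul_comp_sub (hV : SpectralRepresentation u V A) (hu : Continuous u)
    (hi : Integrable u) {a : ℝ} (ha : 0 < a) (ha' : a < 1) (x : ℝ) :
    ((∫ t in Ioi (0 : ℝ), t ^ (a - 1) * u (x - t) : ℝ) : ℂ) =
      ∫ w, V w * (Complex.exp (freq w * x) * (Real.Gamma a * freq w ^ (-a : ℂ))) := by
  have hl : Tendsto (fun ε : ℝ => ∫ t in Ioi (0 : ℝ),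
      ((t ^ (a - 1) * Real.exp (-(ε * t)) * u (x - t) : ℝ) : ℂ)) (𝓝[>] 0)
      (𝓝 (∫ t in Ioi (0 : ℝ), ((t ^ (a - 1) * u (x - t) : ℝ) : ℂ))) := by
    refine tendsto_integral_filter_of_dominated_convergence
      (fun t => ‖t ^ (a - 1) * u (x - t)‖) (Eventually.of_forall fun ε => ?_) ?_
      (hV.integrableOn_rpow_mul_comp_sub hu hi ha ha' x).norm (Eventually.of_forall fun t => ?_)
    · have := hu.measurable
      exact Measurable.aestronglyMeasurable (by fun_prop)
    · filter_upwards [self_mem_nhdsWithin] with ε hε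
      filter_upwards [ae_restrict_mem measurableSet_Ioi] with t ht
      have h1 : Real.exp (-(ε * t)) ≤ 1 := by
        rw [Real.exp_le_one_iff]
        have : 0 < ε * t := mul_pos hε ht
        linarith
      rw [Complex.norm_real, mul_right_comm, norm_mul, Real.norm_of_nonneg (Real.exp_pos _).le]
      exact mul_le_of_le_one_right (norm_nonneg _) h1
    · have hc : Continuous fun ε : ℝ =>
          ((t ^ (a - 1) * Real.exp (-(ε * t)) * u (x - t) : ℝ) : ℂ) := by fun_prop
      have h := (hc.tendsto 0).mono_left (nhdsWithin_le_nhds (s := Ioi 0))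
      simpa using h
  have hr : Tendsto (fun ε : ℝ =>
      ∫ w, V w * (Complex.exp (freq w * x) * (Real.Gamma a * (ε + freq w) ^ (-a : ℂ)))) (𝓝[>] 0)
      (𝓝 (∫ w, V w * (Complex.exp (freq w * x) * (Real.Gamma a * freq w ^ (-a : ℂ))))) := by
    have hG : 0 < Real.Gamma a := Real.Gamma_pos_of_pos ha
    have hVm := hV.continuous.measurable
    have hw0 : ∀ᵐ w : ℝ, w ≠ 0 := by simp [ae_iff]
    refine tendsto_integral_filter_of_dominated_convergence
      (fun w => Real.Gamma a * (2 * Real.pi) ^ (-a) * (|w| ^ (-a) * ‖V w‖))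
      (Eventually.of_forall fun ε => Measurable.aestronglyMeasurable (by fun_prop)) ?_
      ((hV.integrable_abs_rpow_mul (by linarith) (by linarith)).const_mul _) ?_
    · filter_upwards [self_mem_nhdsWithin] with ε hε
      filter_upwards [hw0] with w hw
      have hn : 0 < ‖freq w‖ := norm_pos_iff.mpr (freq_ne_zero hw)
      have hle : ‖freq w‖ ≤ ‖ε + freq w‖ := by
        have h1 : ‖freq w‖ = |(ε + freq w).im| := by
          simp [freq, abs_of_pos Real.pi_pos, abs_mul]
        rw [h1]
        exact Complex.abs_im_le_norm _
      have h2 : ‖((ε : ℂ) + freq w) ^ (-a : ℂ)‖ ≤ (2 * Real.pi) ^ (-a) * |w| ^ (-a) := by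
        rw [← Complex.ofReal_neg, Complex.norm_cpow_real,
          ← Real.mul_rpow (by positivity) (by positivity), ← norm_freq]
        exact Real.rpow_le_rpow_of_nonpos hn hle (by linarith)
      rw [norm_mul, norm_mul, norm_mul, norm_exp_freq_mul, Complex.norm_real,
        Real.norm_of_nonneg hG.le, one_mul]
      calc ‖V w‖ * (Real.Gamma a * ‖((ε : ℂ) + freq w) ^ (-a : ℂ)‖)
          ≤ ‖V w‖ * (Real.Gamma a * ((2 * Real.pi) ^ (-a) * |w| ^ (-a))) := by gcongr
        _ = _ := by ring
    · filter_upwards [hw0] with w hw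
      refine (tendsto_const_nhds.mul (tendsto_const_nhds.mul (tendsto_const_nhds.mul ?_)))
      have hslit : freq w ∈ Complex.slitPlane := by
        refine Or.inr ?_
        simp [freq, hw, Real.pi_ne_zero]
      have hc : ContinuousAt (fun ε : ℝ => ((ε : ℂ) + freq w) ^ (-a : ℂ)) 0 := by
        refine ContinuousAt.cpow (by fun_prop) continuousAt_const ?_
        simpa using hslit
      have := hc.tendsto.mono_left (nhdsWithin_le_nhds (s := Ioi 0))
      simpa using this
  rw [← integral_complex_ofReal]
  refine tendsto_nhds_unique hl (hr.congr' ?_)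
  filter_upwards [self_mem_nhdsWithin] with ε hε
  exact (hV.integral_damped ha hε x).symm

end SpectralRepresentation

lemma natCeil_eq_two {α : ℝ} (h1 : 1 < α) (h2 : α < 2) : ⌈α⌉₊ = 2 := by
  rw [Nat.ceil_eq_iff two_ne_zero]
  norm_num
  exact ⟨h1, h2.le⟩

lemma preimage_sub_left_Iio (x : ℝ) : (fun t : ℝ => x - t) ⁻¹' Iio x = Ioi 0 := by
  ext t; simp

lemma leftRLIntegral_eq {α : ℝ} (h1 : 1 < α) (h2 : α < 2) (u : ℝ → ℝ) (x : ℝ) :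
    leftRLIntegral α u x = ∫ t in Ioi (0 : ℝ), t ^ ((2 - α) - 1) * u (x - t) := by
  rw [leftRLIntegral, natCeil_eq_two h1 h2,
    ← (Measure.measurePreserving_sub_left volume x).setIntegral_preimage_emb
      (MeasurableEquiv.subLeft x).measurableEmbedding _ (Iio x), preimage_sub_left_Iio]
  simp

lemma integrableOn_leftRLIntegral_iff {α : ℝ} (h1 : 1 < α) (h2 : α < 2) (u : ℝ → ℝ) (x : ℝ) :
    IntegrableOn (fun s : ℝ => (x - s) ^ ((⌈α⌉₊ : ℝ) - α - 1) * u s) (Iio x) ↔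
      IntegrableOn (fun t : ℝ => t ^ ((2 - α) - 1) * u (x - t)) (Ioi 0) := by
  rw [natCeil_eq_two h1 h2, ← (Measure.measurePreserving_sub_left volume x).integrableOn_comp_preimage
      (MeasurableEquiv.subLeft x).measurableEmbedding, preimage_sub_left_Iio]
  simp [Function.comp_def]

/-- An integral `∫ m(w) e^{2πiwx} dw` is twice continuously differentiable in `x`, with the
expected derivative, if `m`, `w m` and `w² m` are integrable. -/
lemma contDiff_two_integral_exp_freq {m : ℝ → ℂ}
    (hm : ∀ n : ℕ, n ≤ 2 → Integrable fun w : ℝ => w ^ n • m w) :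
    ContDiff ℝ 2 (fun x : ℝ => ∫ w, m w * Complex.exp (freq w * x)) ∧
    iteratedDeriv 2 (fun x : ℝ => ∫ w, m w * Complex.exp (freq w * x)) =
      fun x : ℝ => ∫ w, freq w ^ 2 * m w * Complex.exp (freq w * x) := by
  have hF : ∀ f : ℝ → ℂ, (fun x : ℝ => ∫ w, f w * Complex.exp (freq w * x)) =
      FourierTransform.fourier (fun w => f (-w)) := by
    intro f
    rw [← Real.fourierInv_eq_fourier_comp_neg]
    ext x
    rw [Real.fourierInv_eq']
    refine integral_congr_ae (Eventually.of_forall fun w => ?_)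
    simp only [smul_eq_mul, freq]
    rw [mul_comm]
    congr 2
    simp
    ring
  have hm' : ∀ n : ℕ, n ≤ (2 : ℕ∞) → Integrable fun w : ℝ => w ^ n • m (-w) := by
    intro n hn
    have h := ((hm n (by exact_mod_cast hn)).comp_neg).const_mul ((-1) ^ n)
    convert! h using 2 with w
    simp only [Complex.real_smul]
    push_cast
    rw [neg_pow (w : ℂ), ← mul_assoc, ← mul_assoc, ← mul_pow]
    simp
  rw [hF m]
  constructor
  · refine Real.contDiff_fourier (N := 2) fun n hn => ?_
    convert! (hm' n hn).norm using 2 with w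
    simp
  · rw [Real.iteratedDeriv_fourier (N := 2) hm' (by norm_num), hF fun w => freq w ^ 2 * m w]
    congr 1
    ext w
    simp [freq]

namespace SpectralRepresentation

variable {u : ℝ → ℝ} {V : ℝ → ℂ} {A : ℝ}

/-- The fractional integral has multiplier `Γ(2-α) * freq w ^ (α-2)`; two derivatives in `x`
contribute `freq w ^ 2`. -/
lemma leftRL_eq_integral (hV : SpectralRepresentation u V A) (hu : Continuous u)
    (hi : Integrable u) {α : ℝ} (h1 : 1 < α) (h2 : α < 2) :
    ContDiff ℝ 2 (leftRLIntegral α u) ∧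
    ∀ x : ℝ, (leftRL α u x : ℂ) =
      ∫ w, V w * (Complex.exp (freq w * x) * freq w ^ (α : ℂ)) := by
  have hVm := hV.continuous.measurable
  have hΓ : Real.Gamma (2 - α) ≠ 0 := (Real.Gamma_pos_of_pos (by linarith)).ne'
  set m : ℝ → ℂ := fun w => Real.Gamma (2 - α) * (V w * freq w ^ ((α - 2 : ℝ) : ℂ)) with hmdef
  have hrep : (fun x => (leftRLIntegral α u x : ℂ)) =
      fun x : ℝ => ∫ w, m w * Complex.exp (freq w * x) := by
    ext x
    rw [leftRLIntegral_eq h1 h2, hV.integral_rpow_mul_comp_sub hu hi (by linarith) (by linarith)]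
    refine integral_congr_ae (Eventually.of_forall fun w => ?_)
    simp only [hmdef]
    push_cast
    rw [neg_sub]
    ring
  have hm : ∀ n : ℕ, n ≤ 2 → Integrable fun w : ℝ => w ^ n • m w := by
    intro n hn
    have hn2 : (n : ℝ) ≤ 2 := by exact_mod_cast hn
    have hn0 : (0 : ℝ) ≤ n := n.cast_nonneg
    have h := (hV.integrable_mul_of_norm_le (s := n + (α - 2)) (C := (2 * Real.pi) ^ (α - 2))
      (m := fun w => (w : ℂ) ^ n * freq w ^ ((α - 2 : ℝ) : ℂ)) (by linarith) (by linarith)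
      (by fun_prop) fun w => ?_).const_mul (Real.Gamma (2 - α) : ℂ)
    · convert! h using 2 with w
      simp only [hmdef, Complex.real_smul]
      push_cast
      ring
    · rw [norm_mul, norm_pow, Complex.norm_real, Real.norm_eq_abs, Complex.norm_cpow_real,
        norm_freq, Real.mul_rpow (by positivity) (abs_nonneg w)]
      -- Exponents add only for a positive base; at `w = 0` the power with exponent `α - 2 ≠ 0` is
      -- `0` by convention.
      by_cases hw : w = 0
      · have : (α - 2) ≠ 0 := by linarith
        simp only [hw, abs_zero, Real.zero_rpow this]
        have : 0 ≤ (2 * Real.pi) ^ (α - 2) * (0 : ℝ) ^ ((n : ℝ) + (α - 2)) := by positivity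
        simpa using this
      · rw [Real.rpow_add (abs_pos.mpr hw), Real.rpow_natCast]
        exact le_of_eq (by ring)
  obtain ⟨hc, hd⟩ := contDiff_two_integral_exp_freq hm
  rw [← hrep] at hc hd
  have hcr : ContDiff ℝ 2 (leftRLIntegral α u) := Complex.reCLM.contDiff.comp hc
  refine ⟨hcr, fun x => ?_⟩
  have hd2 := congrFun hd x
  rw [iteratedDeriv_ofReal_comp (n := 2) hcr] at hd2
  rw [leftRL, natCeil_eq_two h1 h2]
  push_cast
  simp only at hd2
  rw [hd2, ← integral_const_mul]
  refine integral_congr_ae (Eventually.of_forall fun w => ?_)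
  have hpow : freq w ^ 2 * freq w ^ ((α - 2 : ℝ) : ℂ) = freq w ^ (α : ℂ) := by
    by_cases hw : freq w = 0
    · have hα : (α : ℂ) ≠ 0 := by exact_mod_cast (by linarith : α ≠ 0)
      simp [hw, hα]
    · rw [← Complex.cpow_natCast, ← Complex.cpow_add _ _ hw]
      push_cast
      congr 1
      ring
  have hΓ' : (Real.Gamma (2 - α) : ℂ) ≠ 0 := by exact_mod_cast hΓ
  simp only [hmdef]
  rw [← hpow]
  field_simp

end SpectralRepresentation

/-! ### The Grünwald operators as multipliers, and the scheme error. -/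

namespace SpectralRepresentation

variable {u : ℝ → ℝ} {V : ℝ → ℂ} {A : ℝ}

lemma summable_grunwaldTerm (hV : SpectralRepresentation u V A) {α : ℝ} (h1 : 1 < α)
    (h2 : α < 2) (h : ℝ) (p : ℤ) (x : ℝ) : Summable (grunwaldTerm α h p u x) := by
  refine Summable.of_norm_bounded
    ((summable_grunwaldWeight h1 h2).norm.mul_right (∫ w, ‖V w‖)) fun k => ?_
  rw [grunwaldTerm, norm_mul]
  gcongr
  exact hV.abs_le _

lemma tsum_grunwaldTerm_eq_integral (hV : SpectralRepresentation u V A) {α : ℝ} (h1 : 1 < α)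
    (h2 : α < 2) (h : ℝ) (p : ℤ) (x : ℝ) :
    ((∑' k, grunwaldTerm α h p u x k : ℝ) : ℂ) =
      ∫ w, V w * (Complex.exp (freq w * x) * (Complex.exp (p * (freq w * h)) *
        (1 - Complex.exp (-(freq w * h))) ^ (α : ℂ))) := by
  set F : ℕ → ℝ → ℂ := fun k w => (grunwaldWeight α k : ℂ) *
    (V w * Complex.exp (freq w * (x - (k - p) * h : ℝ))) with hF
  have hFi : ∀ k, Integrable (F k) := fun k => by
    refine (Integrable.mul_bdd (c := 1) hV.integrable
      (Measurable.aestronglyMeasurable (by fun_prop)) ?_).const_mul _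
    exact Eventually.of_forall fun w => (norm_exp_freq_mul _ _).le
  have hFn : ∀ k, ∫ w, ‖F k w‖ = ‖grunwaldWeight α k‖ * ∫ w, ‖V w‖ := fun k => by
    simp only [hF, norm_mul, norm_exp_freq_mul, mul_one, Complex.norm_real, integral_const_mul]
  -- Absolute summability of the weights allows sum and integral to be exchanged.
  have hs := hasSum_integral_of_summable_integral_norm hFi (by
    simp only [hFn]
    exact (summable_grunwaldWeight h1 h2).norm.mul_right _)
  have hterm : ∀ k, ∫ w, F k w = (grunwaldTerm α h p u x k : ℂ) := fun k => by
    rw [grunwaldTerm, Complex.ofReal_mul, hV.eq_integral, ← integral_const_mul]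
  simp only [hterm] at hs
  rw [Complex.ofReal_tsum, hs.tsum_eq]
  refine integral_congr_ae (Eventually.of_forall fun w => ?_)
  have hw : ‖Complex.exp (-(freq w * h))‖ ≤ 1 := by
    rw [Complex.norm_exp]
    simp [freq_re]
  simp only
  rw [← tsum_grunwaldWeight_mul_pow h1 h2 hw, ← tsum_mul_left, ← tsum_mul_left, ← tsum_mul_left]
  congr 1
  ext k
  simp only [hF]
  rw [← Complex.exp_nat_mul]
  push_cast
  rw [show freq w * (x - (k - p) * h : ℂ) =
    freq w * x + (p * (freq w * h) + k * -(freq w * h)) by ring, Complex.exp_add, Complex.exp_add]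
  ring

/-- The error of the scheme as an integral against the symbol error. -/
lemma scheme_error_eq_integral (hV : SpectralRepresentation u V A) (hu : Continuous u)
    (hi : Integrable u) {α h : ℝ} (h1 : 1 < α) (h2 : α < 2) (hh : 0 < h) (x : ℝ) :
    ((fiveCWSGD α h (leftRL α u) x - (muOne α * shiftedGrunwald α h 1 u x +
      muZero α * shiftedGrunwald α h 0 u x + muNegOne α * shiftedGrunwald α h (-1) u x) : ℝ) : ℂ) =
    ∫ w, V w * (Complex.exp (freq w * x) * ((h ^ (-α) : ℝ) * symbolError α (freq w * h))) := by
  have hVm := hV.continuous.measurable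
  have hα : 0 < α := by linarith
  have hcα : (α : ℂ) ≠ 0 := by exact_mod_cast hα.ne'
  obtain ⟨-, hRL⟩ := hV.leftRL_eq_integral hu hi h1 h2
  have hRLi : ∀ y : ℝ, Integrable fun w =>
      V w * (Complex.exp (freq w * y) * freq w ^ (α : ℂ)) := fun y => by
    refine hV.integrable_mul_of_norm_le (s := α) (C := (2 * Real.pi) ^ α) (by linarith)
      (by linarith) (by fun_prop) fun w => ?_
    rw [norm_mul, norm_exp_freq_mul, one_mul, Complex.norm_cpow_real, norm_freq,
      Real.mul_rpow (by positivity) (abs_nonneg w)]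
  have hGi : ∀ p : ℤ, Integrable fun w => V w * (Complex.exp (freq w * x) *
      (Complex.exp (p * (freq w * h)) * (1 - Complex.exp (-(freq w * h))) ^ (α : ℂ))) := fun p => by
    refine hV.integrable_mul_of_norm_le (s := 0) (C := 2 ^ α) (by norm_num) (by norm_num)
      (by fun_prop) fun w => ?_
    have e1 : ‖Complex.exp (p * (freq w * h))‖ = 1 := by
      rw [Complex.norm_exp]; simp [freq_re]
    have e2 : ‖Complex.exp (-(freq w * h))‖ = 1 := by
      rw [Complex.norm_exp]; simp [freq_re]
    rw [norm_mul, norm_mul, norm_exp_freq_mul, e1, one_mul, one_mul, Complex.norm_cpow_real,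
      Real.rpow_zero, mul_one]
    refine Real.rpow_le_rpow (norm_nonneg _) ((norm_sub_le _ _).trans ?_) hα.le
    rw [e2, norm_one]; norm_num
  have hGr : ∀ p : ℤ, (shiftedGrunwald α h p u x : ℂ) = (h ^ (-α) : ℝ) *
      ∫ w, V w * (Complex.exp (freq w * x) * (Complex.exp (p * (freq w * h)) *
        (1 - Complex.exp (-(freq w * h))) ^ (α : ℂ))) := fun p => by
    rw [shiftedGrunwald, Complex.ofReal_mul, hV.tsum_grunwaldTerm_eq_integral h1 h2, one_div,
      Real.rpow_neg hh.le]
  -- Multiplication by `h > 0` leaves the argument unchanged, so no branch problem arises.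
  have hscale : ∀ w, freq w ^ (α : ℂ) = (h ^ (-α) : ℝ) * (freq w * h) ^ (α : ℂ) := fun w => by
    by_cases hw : freq w = 0
    · simp [hw, hcα]
    · have hh' : (h : ℂ) ≠ 0 := by exact_mod_cast hh.ne'
      rw [Complex.cpow_def_of_ne_zero (mul_ne_zero hw hh'), Complex.log_mul_ofReal h hh _ hw,
        Complex.cpow_def_of_ne_zero hw, Real.rpow_def_of_pos hh, Complex.ofReal_exp,
        ← Complex.exp_add]
      congr 1
      push_cast
      ring
  simp only [fiveCWSGD]
  push_cast
  rw [hRL, hRL, hRL, hGr, hGr, hGr]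
  simp only [← integral_const_mul]
  have hR : ∀ (c : ℂ) (y : ℝ), Integrable fun w =>
      c * (V w * (Complex.exp (freq w * y) * freq w ^ (α : ℂ))) := fun c y => (hRLi y).const_mul c
  have hG : ∀ (c : ℂ) (p : ℤ), Integrable fun w => c * (((h ^ (-α) : ℝ) : ℂ) *
      (V w * (Complex.exp (freq w * x) * (Complex.exp (p * (freq w * h)) *
        (1 - Complex.exp (-(freq w * h))) ^ (α : ℂ))))) :=
    fun c p => ((hGi p).const_mul _).const_mul c
  rw [← integral_add (hR _ _) (hRLi _), ← integral_add ((hR _ _).fun_add (hRLi _)) (hR _ _),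
    ← integral_add (hG _ _) (hG _ _), ← integral_add ((hG _ _).fun_add (hG _ _)) (hG _ _),
    ← integral_sub (((hR _ _).fun_add (hRLi _)).fun_add (hR _ _))
      (((hG _ _).fun_add (hG _ _)).fun_add (hG _ _))]
  refine integral_congr_ae (Eventually.of_forall fun w => ?_)
  simp only [hscale, symbolError]
  push_cast
  rw [show freq w * (x - h : ℂ) = freq w * x + -(freq w * h) by ring,
    show freq w * (x + h : ℂ) = freq w * x + freq w * h by ring, Complex.exp_add, Complex.exp_add]
  simp only [one_mul, zero_mul, neg_mul, Complex.exp_zero]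
  ring

end SpectralRepresentation

end FifthOrderCWSGD

end

open FifthOrderCWSGD

theorem mainTheorem8 (α : ℝ) (hα₁ : 1 < α) (hα₂ : α < 2)
    (hden : FifthOrderCWSGD.denom α ≠ 0) :
    (∀ g₁ g₂ m₁ m₀ m₂ : ℝ,
      FifthOrderCWSGD.CoefficientSystem α g₁ g₂ m₁ m₀ m₂ ↔
        g₁ = FifthOrderCWSGD.gammaOne α ∧ g₂ = FifthOrderCWSGD.gammaTwo α ∧
        m₁ = FifthOrderCWSGD.muOne α ∧ m₀ = FifthOrderCWSGD.muZero α ∧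
        m₂ = FifthOrderCWSGD.muNegOne α) ∧
    ∀ u : ℝ → ℝ, ContDiff ℝ 8 u →
      (∀ k : ℕ, k ≤ 8 → MeasureTheory.Integrable (iteratedDeriv k u) MeasureTheory.volume) →
      -- the fractional derivative and the Grünwald series are well defined
      (∀ x : ℝ, MeasureTheory.IntegrableOn
        (fun s : ℝ => (x - s) ^ ((⌈α⌉₊ : ℝ) - α - 1) * u s) (Set.Iio x)
        MeasureTheory.volume) ∧
      ContDiff ℝ (⌈α⌉₊ : ℕ) (FifthOrderCWSGD.leftRLIntegral α u) ∧
      (∀ h : ℝ, 0 < h → ∀ (p : ℤ) (x : ℝ),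
        Summable (FifthOrderCWSGD.grunwaldTerm α h p u x)) ∧
      -- fifth order accuracy, uniformly in `x`
      ∃ C h₀ : ℝ, 0 < h₀ ∧ ∀ h : ℝ, 0 < h → h < h₀ → ∀ x : ℝ,
        |FifthOrderCWSGD.fiveCWSGD α h (FifthOrderCWSGD.leftRL α u) x -
          (FifthOrderCWSGD.muOne α * FifthOrderCWSGD.shiftedGrunwald α h 1 u x +
            FifthOrderCWSGD.muZero α * FifthOrderCWSGD.shiftedGrunwald α h 0 u x +
            FifthOrderCWSGD.muNegOne α * FifthOrderCWSGD.shiftedGrunwald α h (-1) u x)|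
          ≤ C * h ^ 5 := by
  refine ⟨fun _ _ _ _ _ => coefficientSystem_iff (by linarith) hden _ _ _ _ _,
    fun u hu hint => ?_⟩
  obtain ⟨V, A, hV⟩ := exists_spectralRepresentation hu hint
  have hui : MeasureTheory.Integrable u := by simpa using hint 0 (by norm_num)
  refine ⟨fun x => ?_, ?_, fun h _ p x => hV.summable_grunwaldTerm hα₁ hα₂ h p x, ?_⟩
  · rw [integrableOn_leftRLIntegral_iff hα₁ hα₂]
    exact hV.integrableOn_rpow_mul_comp_sub hu.continuous hui (by linarith) (by linarith) x
  · rw [natCeil_eq_two hα₁ hα₂]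
    exact (hV.leftRL_eq_integral hu.continuous hui hα₁ hα₂).1
  obtain ⟨C, hC⟩ := exists_norm_symbolError_le (by linarith) hden
  -- The estimate holds for every `h > 0`, so `h₀ = 1` is arbitrary. The factor `h^(-α)` cancels the
  -- `h^α` in `‖freq w * h‖^(5+α)`.
  refine ⟨∫ w, C * (2 * Real.pi) ^ (5 + α) * (|w| ^ (5 + α) * ‖V w‖), 1, one_pos,
    fun h hh _ x => ?_⟩
  rw [← Real.norm_eq_abs, ← Complex.norm_real,
    hV.scheme_error_eq_integral hu.continuous hui hα₁ hα₂ hh, ← MeasureTheory.integral_mul_const]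
  refine MeasureTheory.norm_integral_le_of_norm_le
    (((hV.integrable_abs_rpow_mul (by linarith) (by linarith)).const_mul _).mul_const _)
    (Filter.Eventually.of_forall fun w => ?_)
  have hp : 0 < h ^ (-α) := Real.rpow_pos_of_pos hh _
  have hnorm : ‖freq w * h‖ ^ (5 + α) =
      (2 * Real.pi) ^ (5 + α) * |w| ^ (5 + α) * (h ^ 5 * h ^ α) := by
    rw [norm_mul, norm_freq, Complex.norm_real, Real.norm_of_nonneg hh.le,
      Real.mul_rpow (by positivity) hh.le, Real.mul_rpow (by positivity) (abs_nonneg w),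
      Real.rpow_add hh]
    norm_cast
  have hinv : h ^ (-α) * h ^ α = 1 := by rw [← Real.rpow_add hh]; simp
  rw [norm_mul, norm_mul, norm_mul, norm_exp_freq_mul, one_mul, Complex.norm_real,
    Real.norm_of_nonneg hp.le]
  calc ‖V w‖ * (h ^ (-α) * ‖symbolError α (freq w * h)‖)
      ≤ ‖V w‖ * (h ^ (-α) * (C * ‖freq w * h‖ ^ (5 + α))) := by
        gcongr
        exact hC _ (by simp [freq_re])
    _ = C * (2 * Real.pi) ^ (5 + α) * (|w| ^ (5 + α) * ‖V w‖) * h ^ 5 * (h ^ (-α) * h ^ α) := by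
        rw [hnorm]; ring
    _ = _ := by rw [hinv, mul_one]
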